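/- \textbf{Theorem.} For $U,U'\in\mathbb{R}_{\ge 0}^{n\times m}$ (allocation instances with $n\ge 1$ agents, the rows, and $m\ge 1$ goods, the columns), a permutation $\pi_{\mathrm a}$ of $[n]$ (an agent matching) and a permutation $\pi_{\mathrm g}$ of $[m]$ (a good matching), let $$D(U,U',\pi_{\mathrm a},\pi_{\mathrm g})=\sum_{i\in[n]}\sum_{j\in[m]}\bigl|U_{i,j}-U'_{\pi_{\mathrm a}(i),\pi_{\mathrm g}(j)}\bigr| .$$ The distance between $U$ and $U'$ witnessed by $\pi_{\mathrm a}$ is $\min_{\pi_{\mathrm g}}D(U,U',\pi_{\mathrm a},\pi_{\mathrm g})$, the minimum over all good matchings; the distance witnessed by $\pi_{\mathrm g}$ is $\min_{\pi_{\mathrm a}}D(U,U',\pi_{\mathrm a},\pi_{\mathrm g})$, the minimum over all agent matchings. (1) Given $U$, $U'$, an agent matching $\pi_{\mathrm a}$ and a number $d$, it can be decided in polynomial time whether the distance between $U$ and $U'$ witnessed by $\pi_{\mathrm a}$ is at most $d$. (2) Given $U$, $U'$, a good matching $\pi_{\mathrm g}$ and a number $d$, it can be decided in polynomial time whether the distance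 between $U$ and $U'$ witnessed by $\pi_{\mathrm g}$ is at most $d$. Here polynomial time means the following: there is one random access machine program, using only addition, subtraction and comparison of numbers, such that (a) for rational input written in binary, its running time in the logarithmic cost measure (every operation is charged the binary length of the numbers it handles) is bounded by a polynomial in the binary length of the input; and (b) for real input, its running time on the real random access machine (every operation on real numbers costs one unit) is bounded by a polynomial in $n$ and $m$; in both cases it always halts with the correct answer. -/

import Mathlib

/-! ## Distances witnessed by matchings -/

section Distances

variable {R : Type} [AddCommGroup R] [LinearOrder R] {n m : ℕ}

/-- The `ℓ₁` distance between the utility matrices `U` and `U'` (rows are agents, columns are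
goods) witnessed by the agent matching `πa` and the good matching `πg`. -/
def matchingDist (U U' : Matrix (Fin n) (Fin m) R)
    (πa : Equiv.Perm (Fin n)) (πg : Equiv.Perm (Fin m)) : R :=
  ∑ i, ∑ j, |U i j - U' (πa i) (πg j)|

/-- The distance witnessed by a fixed agent matching: the minimum over all good matchings. -/
def agentDist (U U' : Matrix (Fin n) (Fin m) R) (πa : Equiv.Perm (Fin n)) : R :=
  Finset.univ.inf' Finset.univ_nonempty fun πg : Equiv.Perm (Fin m) => matchingDist U U' πa πg

/-- The distance witnessed by a fixed good matching: the minimum over all agent matchings. -/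
def goodDist (U U' : Matrix (Fin n) (Fin m) R) (πg : Equiv.Perm (Fin m)) : R :=
  Finset.univ.inf' Finset.univ_nonempty fun πa : Equiv.Perm (Fin n) => matchingDist U U' πa πg

end Distances

/-! ## Random access machines

A machine has integer registers and integer arrays (contents in `ℕ`), and value registers and
value arrays (contents in an ordered group `R`, here `ℚ` or `ℝ`). Arrays are addressed by computed
integers. The only operations are addition, subtraction (truncated on `ℕ`) and comparison; there is
no multiplication, division or rounding, and a program is a finite object that does not mention
`R`.

Every operation is charged one unit plus the sizes of the numbers it handles. The size of an
integer is its binary length. The size of a value is given by a function `sz : R → ℕ`: with binary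
length on `ℚ` this is the logarithmic cost measure, with `sz = 1` on `ℝ` it is the unit cost measure
of a real random access machine. -/

namespace RAM

/-- Integer expressions: constants, registers, `A_a[e]`, sums and truncated differences. -/
inductive IExp : Type
  | const (c : ℕ)
  | reg (x : ℕ)
  | arr (a : ℕ) (e : IExp)
  | add (e f : IExp)
  | sub (e f : IExp)

/-- Value expressions: zero, registers, `V_a[e]`, sums and differences. -/
inductive VExp : Type
  | zero
  | reg (x : ℕ)
  | arr (a : ℕ) (e : IExp)
  | add (e f : VExp)
  | sub (e f : VExp)

/-- Tests: comparison of two integers or of two values. -/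
inductive Test : Type
  | ilt (e f : IExp)
  | vlt (e f : VExp)

/-- Programs. -/
inductive Prog : Type
  | skip
  | iset (x : ℕ) (e : IExp)
  | vset (x : ℕ) (e : VExp)
  | istore (a : ℕ) (e f : IExp)
  | vstore (a : ℕ) (e : IExp) (f : VExp)
  | seq (P Q : Prog)
  | branch (t : Test) (P Q : Prog)
  | loop (t : Test) (P : Prog)

/-- Memory: registers, and arrays given as `arr name address`. -/
structure Mem (R : Type) where
  ireg : ℕ → ℕ
  iarr : ℕ → ℕ → ℕ
  vreg : ℕ → R
  varr : ℕ → ℕ → R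

section Semantics

variable {R : Type} [AddCommGroup R] [LinearOrder R]

/-- Value of an integer expression. -/
def IExp.eval (s : Mem R) : IExp → ℕ
  | .const c => c
  | .reg x => s.ireg x
  | .arr a e => s.iarr a (e.eval s)
  | .add e f => e.eval s + f.eval s
  | .sub e f => e.eval s - f.eval s

/-- Value of a value expression. -/
def VExp.eval (s : Mem R) : VExp → R
  | .zero => 0
  | .reg x => s.vreg x
  | .arr a e => s.varr a (e.eval s)
  | .add e f => e.eval s + f.eval s
  | .sub e f => e.eval s - f.eval s

/-- Cost of evaluating an integer expression: every node is charged one unit plus the binary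
length of its value. -/
def IExp.cost (s : Mem R) : IExp → ℕ
  | .const c => 1 + Nat.size c
  | .reg x => 1 + Nat.size (s.ireg x)
  | .arr a e => e.cost s + (1 + Nat.size (s.iarr a (e.eval s)))
  | .add e f => e.cost s + f.cost s + (1 + Nat.size (e.eval s + f.eval s))
  | .sub e f => e.cost s + f.cost s + (1 + Nat.size (e.eval s - f.eval s))

/-- Cost of evaluating a value expression: every node is charged one unit plus the size of its
value. -/
def VExp.cost (sz : R → ℕ) (s : Mem R) : VExp → ℕ
  | .zero => 1 + sz 0
  | .reg x => 1 + sz (s.vreg x)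
  | .arr a e => e.cost s + (1 + sz (s.varr a (e.eval s)))
  | .add e f => e.cost sz s + f.cost sz s + (1 + sz (e.eval s + f.eval s))
  | .sub e f => e.cost sz s + f.cost sz s + (1 + sz (e.eval s - f.eval s))

/-- Truth of a test. -/
def Test.Holds (s : Mem R) : Test → Prop
  | .ilt e f => e.eval s < f.eval s
  | .vlt e f => e.eval s < f.eval s

/-- Cost of a test. -/
def Test.cost (sz : R → ℕ) (s : Mem R) : Test → ℕ
  | .ilt e f => e.cost s + f.cost s + 1
  | .vlt e f => e.cost sz s + f.cost sz s + 1

/-- Write an integer into an integer register. -/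
def Mem.setIreg (s : Mem R) (x k : ℕ) : Mem R := { s with ireg := Function.update s.ireg x k }

/-- Write a value into a value register. -/
def Mem.setVreg (s : Mem R) (x : ℕ) (v : R) : Mem R :=
  { s with vreg := Function.update s.vreg x v }

/-- Write an integer into a cell of an integer array. -/
def Mem.setIarr (s : Mem R) (a i k : ℕ) : Mem R :=
  { s with iarr := Function.update s.iarr a (Function.update (s.iarr a) i k) }

/-- Write a value into a cell of a value array. -/
def Mem.setVarr (s : Mem R) (a i : ℕ) (v : R) : Mem R :=
  { s with varr := Function.update s.varr a (Function.update (s.varr a) i v) }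

/-- `Exec sz P s c s'`: the program `P`, started with memory `s`, halts with memory `s'`, and the
total cost of this run is `c`. -/
inductive Exec (sz : R → ℕ) : Prog → Mem R → ℕ → Mem R → Prop
  | skip (s : Mem R) : Exec sz .skip s 1 s
  | iset (x : ℕ) (e : IExp) (s : Mem R) :
      Exec sz (.iset x e) s (e.cost s + 1) (s.setIreg x (e.eval s))
  | vset (x : ℕ) (e : VExp) (s : Mem R) :
      Exec sz (.vset x e) s (e.cost sz s + 1) (s.setVreg x (e.eval s))
  | istore (a : ℕ) (e f : IExp) (s : Mem R) :
      Exec sz (.istore a e f) s (e.cost s + f.cost s + 1) (s.setIarr a (e.eval s) (f.eval s))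
  | vstore (a : ℕ) (e : IExp) (f : VExp) (s : Mem R) :
      Exec sz (.vstore a e f) s (e.cost s + f.cost sz s + 1)
        (s.setVarr a (e.eval s) (f.eval s))
  | seq {P Q : Prog} {s s' s'' : Mem R} {c c' : ℕ} :
      Exec sz P s c s' → Exec sz Q s' c' s'' → Exec sz (.seq P Q) s (c + c') s''
  | branch_true {t : Test} {P Q : Prog} {s s' : Mem R} {c : ℕ} :
      t.Holds s → Exec sz P s c s' → Exec sz (.branch t P Q) s (t.cost sz s + c) s'
  | branch_false {t : Test} {P Q : Prog} {s s' : Mem R} {c : ℕ} :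
      ¬ t.Holds s → Exec sz Q s c s' → Exec sz (.branch t P Q) s (t.cost sz s + c) s'
  | loop_true {t : Test} {P : Prog} {s s' s'' : Mem R} {c c' : ℕ} :
      t.Holds s → Exec sz P s c s' → Exec sz (.loop t P) s' c' s'' →
        Exec sz (.loop t P) s (t.cost sz s + c + c') s''
  | loop_false {t : Test} {P : Prog} {s : Mem R} :
      ¬ t.Holds s → Exec sz (.loop t P) s (t.cost sz s) s

/-- Programs are deterministic: the final memory and the cost of a run are unique. -/
theorem Exec.deterministic {sz : R → ℕ} {P : Prog} {s s₁ s₂ : Mem R} {c₁ c₂ : ℕ}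
    (h₁ : Exec sz P s c₁ s₁) (h₂ : Exec sz P s c₂ s₂) : c₁ = c₂ ∧ s₁ = s₂ := by
  induction h₁ generalizing c₂ s₂ with
  | skip s => cases h₂; exact ⟨rfl, rfl⟩
  | iset x e s => cases h₂; exact ⟨rfl, rfl⟩
  | vset x e s => cases h₂; exact ⟨rfl, rfl⟩
  | istore a e f s => cases h₂; exact ⟨rfl, rfl⟩
  | vstore a e f s => cases h₂; exact ⟨rfl, rfl⟩
  | seq _ _ ih ih' =>
    cases h₂ with
    | seq g g' =>
      obtain ⟨rfl, rfl⟩ := ih g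
      obtain ⟨rfl, rfl⟩ := ih' g'
      exact ⟨rfl, rfl⟩
  | branch_true ht _ ih =>
    cases h₂ with
    | branch_true _ g => obtain ⟨rfl, rfl⟩ := ih g; exact ⟨rfl, rfl⟩
    | branch_false hf _ => exact absurd ht hf
  | branch_false hf _ ih =>
    cases h₂ with
    | branch_true ht _ => exact absurd ht hf
    | branch_false _ g => obtain ⟨rfl, rfl⟩ := ih g; exact ⟨rfl, rfl⟩
  | loop_true ht _ _ ih ih' =>
    cases h₂ with
    | loop_true _ g g' =>
      obtain ⟨rfl, rfl⟩ := ih g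
      obtain ⟨rfl, rfl⟩ := ih' g'
      exact ⟨rfl, rfl⟩
    | loop_false hf => exact absurd ht hf
  | loop_false hf =>
    cases h₂ with
    | loop_true ht _ _ => exact absurd ht hf
    | loop_false _ => exact ⟨rfl, rfl⟩

end Semantics

/-- Binary size of a rational number: the binary lengths of numerator and denominator. -/
def ratSize (q : ℚ) : ℕ := Nat.size q.num.natAbs + Nat.size q.den

/-- Unit size of a real number. -/
def realSize (_ : ℝ) : ℕ := 1

section Input

variable {R : Type} [AddCommGroup R] [LinearOrder R] {n m k : ℕ}

/-- Row-major listing of the entries of a matrix, followed by zeros. -/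
def rowMajor (U : Matrix (Fin n) (Fin m) R) (t : ℕ) : R :=
  if h : t < n * m then U (Fin.divNat ⟨t, h⟩) (Fin.modNat ⟨t, h⟩) else 0

/-- Table of a permutation of `{0, …, k - 1}`, followed by zeros. -/
def permTable (π : Equiv.Perm (Fin k)) (t : ℕ) : ℕ :=
  if h : t < k then (π ⟨t, h⟩ : ℕ) else 0

/-- The initial memory for the input `(U, U', π, d)`: integer registers `0` and `1` hold `n` and
`m`, integer array `0` holds the table of `π`, value register `0` holds `d`, and the value arrays
`0` and `1` hold the entries of `U` and `U'`. All other cells are zero. -/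
def inputMem (U U' : Matrix (Fin n) (Fin m) R) (π : Equiv.Perm (Fin k)) (d : R) : Mem R where
  ireg x := if x = 0 then n else if x = 1 then m else 0
  iarr a t := if a = 0 then permTable π t else 0
  vreg x := if x = 0 then d else 0
  varr a t := if a = 0 then rowMajor U t else if a = 1 then rowMajor U' t else 0

/-- The length of the input `(U, U', π, d)`. -/
def inputSize (sz : R → ℕ) (U U' : Matrix (Fin n) (Fin m) R) (π : Equiv.Perm (Fin k)) (d : R) :
    ℕ :=
  Nat.size n + Nat.size m + (∑ i, (1 + Nat.size (π i : ℕ))) + (∑ i, ∑ j, sz (U i j)) +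
    (∑ i, ∑ j, sz (U' i j)) + sz d

/-- From the memory `s`, the program `P` halts at cost at most `b`, and integer register `0` then
holds the answer: `1` if `A` is true, `0` if `A` is false. -/
def Decides (sz : R → ℕ) (P : Prog) (s : Mem R) (b : ℕ) (A : Prop) : Prop :=
  ∃ (c : ℕ) (s' : Mem R), Exec sz P s c s' ∧ c ≤ b ∧
    (A → s'.ireg 0 = 1) ∧ (¬ A → s'.ireg 0 = 0)

end Input

/-- The program `P` decides within the cost bound `p (input length)`, for all allocation instances
`U`, `U'` with nonnegative entries in `R`, all agent matchings `πa` and all numbers `d`, whether the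
distance between `U` and `U'` witnessed by `πa` is at most `d`. -/
def SolvesFixedAgent {R : Type} [AddCommGroup R] [LinearOrder R] (sz : R → ℕ) (P : Prog)
    (p : Polynomial ℕ) : Prop :=
  ∀ (n m : ℕ), 0 < n → 0 < m → ∀ U U' : Matrix (Fin n) (Fin m) R,
    (∀ i j, 0 ≤ U i j) → (∀ i j, 0 ≤ U' i j) → ∀ (πa : Equiv.Perm (Fin n)) (d : R),
      Decides sz P (inputMem U U' πa d) (p.eval (inputSize sz U U' πa d)) (agentDist U U' πa ≤ d)

/-- The program `P` decides within the cost bound `p (input length)`, for all allocation instances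
`U`, `U'` with nonnegative entries in `R`, all good matchings `πg` and all numbers `d`, whether the
distance between `U` and `U'` witnessed by `πg` is at most `d`. -/
def SolvesFixedGood {R : Type} [AddCommGroup R] [LinearOrder R] (sz : R → ℕ) (P : Prog)
    (p : Polynomial ℕ) : Prop :=
  ∀ (n m : ℕ), 0 < n → 0 < m → ∀ U U' : Matrix (Fin n) (Fin m) R,
    (∀ i j, 0 ≤ U i j) → (∀ i j, 0 ≤ U' i j) → ∀ (πg : Equiv.Perm (Fin m)) (d : R),
      Decides sz P (inputMem U U' πg d) (p.eval (inputSize sz U U' πg d)) (goodDist U U' πg ≤ d)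

end RAM

/-! Once one matching is fixed, the distance is the optimum of an assignment problem. For a fixed
agent matching, assigning good `h` to good `g` costs `∑ l, |U l g - U' (πa l) h|`, and these costs
add up independently; for a fixed good matching the roles of rows and columns are exchanged. Such a
problem is solved by the Hungarian method, which only adds, subtracts and compares.

Optimality is linear programming duality: potentials with `u i + v j ≤ c i j` bound the cost of
every permutation from below by their sum, and a permutation all of whose edges are tight attains
the bound (`HungarianState.inf'_eq`). The sum of the final potentials is therefore compared with
`d`. The form of the method used here keeps, for each row `i` of the alternating tree, a whole
permutation `M i` that is tight on the rows up to the root `k` other than `i`. It is the current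
matching with the tree path from the root to `i` already flipped, so both growing the tree and
augmenting are a transposition of two columns (`extend`, `augment`). The change of potentials is
`shift`, and `wp_round` transfers these three lemmas to the program.

The running time is separated from correctness. `wp` records what a program computes when each loop
makes at most `N` iterations per entry; this bounds the number of operations by a polynomial in `N`.
An operation raises the magnitude of numbers by at most one binary digit, as there is no
multiplication, so `wp.exec` converts few operations into low cost. On `ℚ` all values stay fractions
over one common denominator of the input, so only the numerators grow; on `ℝ` sizes are constant.
The programs and polynomials do not depend on the group of values, so the same pair serves `ℚ` and
`ℝ`. -/

set_option linter.unusedSectionVars false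

namespace RAM

/-! ## Weakest preconditions -/

section WP

variable {R : Type} [AddCommGroup R] [LinearOrder R]

/-- Number of nodes of an integer expression, a constant `c` counting `1 + c`. -/
def IExp.nodes : IExp → ℕ
  | .const c => 1 + c
  | .reg _ => 1
  | .arr _ e => e.nodes + 1
  | .add e f => e.nodes + f.nodes + 1
  | .sub e f => e.nodes + f.nodes + 1

/-- Number of nodes of a value expression. -/
def VExp.nodes : VExp → ℕ
  | .zero => 1
  | .reg _ => 1
  | .arr _ e => e.nodes + 1
  | .add e f => e.nodes + f.nodes + 1
  | .sub e f => e.nodes + f.nodes + 1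

/-- Number of nodes of a test. -/
def Test.nodes : Test → ℕ
  | .ilt e f => e.nodes + f.nodes + 1
  | .vlt e f => e.nodes + f.nodes + 1

/-- Bound for the number of operations of a program in which every loop is iterated at most `N`
times each time it is entered. -/
def Prog.ops (N : ℕ) : Prog → ℕ
  | .skip => 1
  | .iset _ e => e.nodes + 1
  | .vset _ e => e.nodes + 1
  | .istore _ e f => e.nodes + f.nodes + 1
  | .vstore _ e f => e.nodes + f.nodes + 1
  | .seq P Q => P.ops N + Q.ops N
  | .branch t P Q => t.nodes + P.ops N + Q.ops N
  | .loop t P => (N + 1) * (t.nodes + P.ops N)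

/-- Weakest precondition of a loop with test `t` that is iterated at most `k` times, where `W` is
the weakest precondition of its body. -/
def loopWp (t : Test) (W : (Mem R → Prop) → Mem R → Prop) (Q : Mem R → Prop) :
    ℕ → Mem R → Prop
  | 0, s => ¬ t.Holds s ∧ Q s
  | k + 1, s => (¬ t.Holds s → Q s) ∧ (t.Holds s → W (loopWp t W Q k) s)

/-- `wp N P Q s`: started with memory `s`, the program `P` halts with a memory that satisfies `Q`,
and every loop is iterated at most `N` times each time it is entered. -/
def wp (N : ℕ) : Prog → (Mem R → Prop) → Mem R → Prop
  | .skip, Q, s => Q s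
  | .iset x e, Q, s => Q (s.setIreg x (e.eval s))
  | .vset x e, Q, s => Q (s.setVreg x (e.eval s))
  | .istore a e f, Q, s => Q (s.setIarr a (e.eval s) (f.eval s))
  | .vstore a e f, Q, s => Q (s.setVarr a (e.eval s) (f.eval s))
  | .seq P P', Q, s => wp N P (wp N P' Q) s
  | .branch t P P', Q, s => (t.Holds s → wp N P Q s) ∧ (¬ t.Holds s → wp N P' Q s)
  | .loop t P, Q, s => loopWp t (wp N P) Q N s

theorem loopWp_mono {t : Test} {W : (Mem R → Prop) → Mem R → Prop}
    (hW : ∀ {Q Q' : Mem R → Prop}, (∀ s, Q s → Q' s) → ∀ s, W Q s → W Q' s)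
    {Q Q' : Mem R → Prop} (h : ∀ s, Q s → Q' s) (k : ℕ) :
    ∀ s, loopWp t W Q k s → loopWp t W Q' k s := by
  induction k with
  | zero => exact fun s hs => ⟨hs.1, h s hs.2⟩
  | succ k ih => exact fun s hs => ⟨fun ht => h s (hs.1 ht), fun ht => hW ih s (hs.2 ht)⟩

theorem wp_mono {N : ℕ} {P : Prog} {Q Q' : Mem R → Prop} (h : ∀ s, Q s → Q' s) :
    ∀ s, wp N P Q s → wp N P Q' s := by
  induction P generalizing Q Q' with
  | skip => exact h
  | iset => exact fun s => h _
  | vset => exact fun s => h _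
  | istore => exact fun s => h _
  | vstore => exact fun s => h _
  | seq P P' ih ih' => exact ih (ih' h)
  | branch t P P' ih ih' =>
    exact fun s hs => ⟨fun ht => ih h s (hs.1 ht), fun ht => ih' h s (hs.2 ht)⟩
  | loop t P ih => exact loopWp_mono (fun h => ih h) h N

theorem wp.imp {N : ℕ} {P : Prog} {Q Q' : Mem R → Prop} {s : Mem R} (hs : wp N P Q s)
    (h : ∀ s, Q s → Q' s) : wp N P Q' s :=
  wp_mono h s hs

/-- `wp` includes termination, so a postcondition that can be reached is satisfiable; the loop rule
needs this to refute a true test when the variant is zero. -/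
theorem wp_exists {N : ℕ} {P : Prog} {Q : Mem R → Prop} : ∀ s, wp N P Q s → ∃ s', Q s' := by
  induction P generalizing Q with
  | skip | iset | vset | istore | vstore => exact fun s h => ⟨_, h⟩
  | seq P P' ih ih' =>
    intro s h
    obtain ⟨s', h'⟩ := ih s h
    exact ih' s' h'
  | branch t P P' ih ih' =>
    intro s h
    by_cases ht : t.Holds s
    · exact ih s (h.1 ht)
    · exact ih' s (h.2 ht)
  | loop t P ih =>
    suffices H : ∀ k s, loopWp t (wp N P) Q k s → ∃ s', Q s' from H N
    intro k
    induction k with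
    | zero => exact fun s h => ⟨s, h.2⟩
    | succ k ihk =>
      intro s h
      by_cases ht : t.Holds s
      · obtain ⟨s', h'⟩ := ih s (h.2 ht)
        exact ihk s' h'
      · exact ⟨s, h.1 ht⟩

/-- Loop rule: an invariant `I` and a variant `μ`. -/
theorem wp_loop {N : ℕ} {t : Test} {P : Prog} {Q : Mem R → Prop} (I : Mem R → Prop)
    (μ : Mem R → ℕ)
    (hstep : ∀ s, I s → t.Holds s → wp N P (fun s' => I s' ∧ μ s' < μ s) s)
    (hQ : ∀ s, I s → ¬ t.Holds s → Q s) {s : Mem R} (hs : I s) (hN : μ s ≤ N) :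
    wp N (.loop t P) Q s := by
  suffices H : ∀ k s, I s → μ s ≤ k → loopWp t (wp N P) Q k s from H N s hs hN
  intro k
  induction k with
  | zero =>
    intro s hs hk
    -- If the test held, the body would end in a memory whose variant is below zero.
    have ht : ¬ t.Holds s := by
      intro ht
      obtain ⟨s', -, h⟩ := wp_exists s (hstep s hs ht)
      omega
    exact ⟨ht, hQ s hs ht⟩
  | succ k ih =>
    intro s hs hk
    exact ⟨hQ s hs, fun ht => (hstep s hs ht).imp fun s' h => ih s' h.1 (by omega)⟩

section Set

variable (s : Mem R)

@[simp] theorem ireg_setIreg (x k y : ℕ) :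
    (s.setIreg x k).ireg y = if y = x then k else s.ireg y := Function.update_apply ..

@[simp] theorem iarr_setIreg (x k : ℕ) : (s.setIreg x k).iarr = s.iarr := rfl

@[simp] theorem vreg_setIreg (x k : ℕ) : (s.setIreg x k).vreg = s.vreg := rfl

@[simp] theorem varr_setIreg (x k : ℕ) : (s.setIreg x k).varr = s.varr := rfl

@[simp] theorem ireg_setVreg (x : ℕ) (v : R) : (s.setVreg x v).ireg = s.ireg := rfl

@[simp] theorem iarr_setVreg (x : ℕ) (v : R) : (s.setVreg x v).iarr = s.iarr := rfl

@[simp] theorem vreg_setVreg (x : ℕ) (v : R) (y : ℕ) :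
    (s.setVreg x v).vreg y = if y = x then v else s.vreg y := Function.update_apply ..

@[simp] theorem varr_setVreg (x : ℕ) (v : R) : (s.setVreg x v).varr = s.varr := rfl

@[simp] theorem ireg_setIarr (a i k : ℕ) : (s.setIarr a i k).ireg = s.ireg := rfl

@[simp] theorem iarr_setIarr (a i k b t : ℕ) :
    (s.setIarr a i k).iarr b t = if b = a ∧ t = i then k else s.iarr b t := by
  by_cases h : b = a <;> simp [Mem.setIarr, Function.update_apply, h]

@[simp] theorem varr_setIarr (a i k : ℕ) : (s.setIarr a i k).varr = s.varr := rfl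

@[simp] theorem ireg_setVarr (a i : ℕ) (v : R) : (s.setVarr a i v).ireg = s.ireg := rfl

@[simp] theorem iarr_setVarr (a i : ℕ) (v : R) : (s.setVarr a i v).iarr = s.iarr := rfl

@[simp] theorem vreg_setVarr (a i : ℕ) (v : R) : (s.setVarr a i v).vreg = s.vreg := rfl

@[simp] theorem varr_setVarr (a i : ℕ) (v : R) (b t : ℕ) :
    (s.setVarr a i v).varr b t = if b = a ∧ t = i then v else s.varr b t := by
  by_cases h : b = a <;> simp [Mem.setVarr, Function.update_apply, h]

end Set

/-- The counting loop `for x := 0 to e - 1 do P`. -/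
def forLoop (x : ℕ) (e : IExp) (P : Prog) : Prog :=
  .seq (.iset x (.const 0))
    (.loop (.ilt (.reg x) e) (.seq P (.iset x (.add (.reg x) (.const 1)))))

/-- Rule for counting loops. -/
theorem wp_forLoop {N n x : ℕ} {e : IExp} {P : Prog} {Q : Mem R → Prop} (I : ℕ → Mem R → Prop)
    (hn : n ≤ N) (hI : ∀ i s, I i s → s.ireg x = i ∧ e.eval s = n)
    (hstep : ∀ i s, i < n → I i s →
      wp N P (fun s' => s'.ireg x = i ∧ I (i + 1) (s'.setIreg x (i + 1))) s)
    {s : Mem R} (h0 : I 0 (s.setIreg x 0)) (hQ : ∀ s, I n s → Q s) :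
    wp N (forLoop x e P) Q s := by
  refine wp_loop (fun s => I (s.ireg x) s ∧ s.ireg x ≤ n) (fun s => n - s.ireg x) ?_ ?_ ?_ ?_
  · rintro s ⟨hs, hle⟩ ht
    have hlt : s.ireg x < n := by simpa [Test.Holds, IExp.eval, (hI _ _ hs).2] using ht
    refine (hstep _ s hlt hs).imp fun s' hs' => ?_
    simp only [wp, IExp.eval, hs'.1]
    simp only [Mem.setIreg, Function.update_self]
    exact ⟨⟨hs'.2, hlt⟩, by omega⟩
  · rintro s ⟨hs, hle⟩ ht
    have hge : ¬ s.ireg x < n := by simpa [Test.Holds, IExp.eval, (hI _ _ hs).2] using ht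
    exact hQ s ((by omega : s.ireg x = n) ▸ hs)
  · simpa [Mem.setIreg, IExp.eval] using h0
  · simp only [IExp.eval, Mem.setIreg, Function.update_self]; omega

/-! ### Frame conditions. -/

/-- The registers and arrays of a memory. -/
inductive Loc : Type
  | ireg (x : ℕ)
  | iarr (a : ℕ)
  | vreg (x : ℕ)
  | varr (a : ℕ)

/-- `P.Writes l`: the text of `P` contains an assignment to `l`. -/
def Prog.Writes : Prog → Loc → Prop
  | .skip, _ => False
  | .iset x _, l => l = .ireg x
  | .vset x _, l => l = .vreg x
  | .istore a _ _, l => l = .iarr a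
  | .vstore a _ _, l => l = .varr a
  | .seq P Q, l => P.Writes l ∨ Q.Writes l
  | .branch _ P Q, l => P.Writes l ∨ Q.Writes l
  | .loop _ P, l => P.Writes l

/-- The memories `s` and `s'` agree outside the locations that `P` writes. -/
structure Frame (P : Prog) (s s' : Mem R) : Prop where
  ireg : ∀ x, ¬ P.Writes (.ireg x) → s'.ireg x = s.ireg x
  iarr : ∀ a, ¬ P.Writes (.iarr a) → s'.iarr a = s.iarr a
  vreg : ∀ x, ¬ P.Writes (.vreg x) → s'.vreg x = s.vreg x
  varr : ∀ a, ¬ P.Writes (.varr a) → s'.varr a = s.varr a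

theorem Frame.refl (P : Prog) (s : Mem R) : Frame P s s :=
  ⟨fun _ _ => rfl, fun _ _ => rfl, fun _ _ => rfl, fun _ _ => rfl⟩

theorem Frame.trans {P : Prog} {s s' s'' : Mem R} (h : Frame P s s') (h' : Frame P s' s'') :
    Frame P s s'' :=
  ⟨fun x hx => (h'.ireg x hx).trans (h.ireg x hx), fun x hx => (h'.iarr x hx).trans (h.iarr x hx),
    fun x hx => (h'.vreg x hx).trans (h.vreg x hx), fun x hx => (h'.varr x hx).trans (h.varr x hx)⟩

theorem Frame.mono {P P' : Prog} (hP : ∀ l, P.Writes l → P'.Writes l) {s s' : Mem R}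
    (h : Frame P s s') : Frame P' s s' :=
  ⟨fun x hx => h.ireg x (mt (hP _) hx), fun x hx => h.iarr x (mt (hP _) hx),
    fun x hx => h.vreg x (mt (hP _) hx), fun x hx => h.varr x (mt (hP _) hx)⟩

/-- A program changes no location that it does not write. -/
theorem wp.frame {N : ℕ} {P : Prog} {Q : Mem R → Prop} {s : Mem R} (hs : wp N P Q s) :
    wp N P (fun s' => Q s' ∧ Frame P s s') s := by
  induction P generalizing Q s with
  | skip => exact ⟨hs, Frame.refl _ _⟩
  | iset x e =>
    refine ⟨hs, ⟨fun y hy => ?_, fun _ _ => rfl, fun _ _ => rfl, fun _ _ => rfl⟩⟩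
    exact Function.update_of_ne (fun h => hy (by rw [h]; rfl)) _ _
  | vset x e =>
    refine ⟨hs, ⟨fun _ _ => rfl, fun _ _ => rfl, fun y hy => ?_, fun _ _ => rfl⟩⟩
    exact Function.update_of_ne (fun h => hy (by rw [h]; rfl)) _ _
  | istore a e f =>
    refine ⟨hs, ⟨fun _ _ => rfl, fun y hy => ?_, fun _ _ => rfl, fun _ _ => rfl⟩⟩
    exact Function.update_of_ne (fun h => hy (by rw [h]; rfl)) _ _
  | vstore a e f =>
    refine ⟨hs, ⟨fun _ _ => rfl, fun _ _ => rfl, fun _ _ => rfl, fun y hy => ?_⟩⟩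
    exact Function.update_of_ne (fun h => hy (by rw [h]; rfl)) _ _
  | seq P P' ih ih' =>
    refine (ih hs).imp fun s₁ h₁ => (ih' h₁.1).imp fun s₂ h₂ => ⟨h₂.1, ?_⟩
    exact (h₁.2.mono fun _ => Or.inl).trans (h₂.2.mono fun _ => Or.inr)
  | branch t P P' ih ih' =>
    exact ⟨fun ht => (ih (hs.1 ht)).imp fun _ h => ⟨h.1, h.2.mono fun _ => Or.inl⟩,
      fun ht => (ih' (hs.2 ht)).imp fun _ h => ⟨h.1, h.2.mono fun _ => Or.inr⟩⟩
  | loop t P ih =>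
    suffices H : ∀ k s, loopWp t (wp N P) Q k s →
      loopWp t (wp N P) (fun s' => Q s' ∧ Frame P s s') k s from
        wp_mono (P := .loop t P) (fun _ h => ⟨h.1, Frame.mono (P := P) (P' := .loop t P) (fun _ hl => hl) h.2⟩) s
          (H N s hs)
    intro k
    induction k with
    | zero => exact fun s h => ⟨h.1, h.2, Frame.refl _ _⟩
    | succ k ihk =>
      refine fun s h => ⟨fun ht => ⟨h.1 ht, Frame.refl _ _⟩, fun ht => ?_⟩
      refine (ih (h.2 ht)).imp fun s₁ h₁ => ?_
      exact loopWp_mono (fun h => wp_mono h) (fun _ h₂ => ⟨h₂.1, h₁.2.trans h₂.2⟩) k s₁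
        (ihk s₁ h₁.1)

@[simp] theorem writes_forLoop {x : ℕ} {e : IExp} {P : Prog} {l : Loc} :
    (forLoop x e P).Writes l ↔ l = .ireg x ∨ P.Writes l := by
  simp only [forLoop, Prog.Writes]; tauto

/-- Rule for counting loops that provides the frame condition. -/
theorem wp_forLoop_frame {N n x : ℕ} {e : IExp} {P : Prog} {Q : Mem R → Prop} {s : Mem R}
    (I : ℕ → Mem R → Prop) (hn : n ≤ N) (hx : ¬ P.Writes (.ireg x))
    (he : ∀ s', Frame (forLoop x e P) s s' → e.eval s' = n)
    (h0 : I 0 (s.setIreg x 0))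
    (hstep : ∀ i s', i < n → Frame (forLoop x e P) s s' → s'.ireg x = i → I i s' →
      wp N P (fun s'' => I (i + 1) (s''.setIreg x (i + 1))) s')
    (hQ : ∀ s', Frame (forLoop x e P) s s' → I n s' → Q s') :
    wp N (forLoop x e P) Q s := by
  have set_frame : ∀ (s' : Mem R) k, Frame (forLoop x e P) s' (s'.setIreg x k) := by
    refine fun s' k => ⟨fun y hy => ?_, fun _ _ => rfl, fun _ _ => rfl, fun _ _ => rfl⟩
    exact Function.update_of_ne (fun h => hy (by rw [h]; simp)) _ _
  refine wp_forLoop (fun i s' => s'.ireg x = i ∧ Frame (forLoop x e P) s s' ∧ I i s') hn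
    (fun i s' h => ⟨h.1, he s' h.2.1⟩) ?_ ⟨by simp [Mem.setIreg], set_frame _ _, h0⟩
    (fun s' h => hQ s' h.2.1 h.2.2)
  rintro i s' hi ⟨hxi, hF, hI⟩
  refine (hstep i s' hi hF hxi hI).frame.imp fun s'' h => ⟨(h.2.ireg x hx).trans hxi, ?_, ?_, h.1⟩
  · simp [Mem.setIreg]
  · exact (hF.trans (h.2.mono fun l hl => writes_forLoop.2 (.inr hl))).trans (set_frame _ _)

end WP

/-! ## Costs from operation counts -/

section Cost

variable {R : Type} [AddCommGroup R] [LinearOrder R]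

/-- A filtration `V` of the values such that sums and differences climb at most one level, and the
size of a value of level `k` is at most `K + k`. -/
structure Filtration (sz : R → ℕ) (K : ℕ) (V : ℕ → R → Prop) : Prop where
  mono : ∀ {j k v}, j ≤ k → V j v → V k v
  zero : ∀ k, V k 0
  add : ∀ {k v w}, V k v → V k w → V (k + 1) (v + w)
  sub : ∀ {k v w}, V k v → V k w → V (k + 1) (v - w)
  size : ∀ {k v}, V k v → sz v ≤ K + k

/-- All numbers in the memory `s` have level at most `k`. -/
structure Mem.Level (V : ℕ → R → Prop) (k : ℕ) (s : Mem R) : Prop where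
  ireg : ∀ x, s.ireg x ≤ 2 ^ k
  iarr : ∀ a t, s.iarr a t ≤ 2 ^ k
  vreg : ∀ x, V k (s.vreg x)
  varr : ∀ a t, V k (s.varr a t)

theorem natSize_le_of_le_two_pow {a k : ℕ} (h : a ≤ 2 ^ k) : Nat.size a ≤ k + 1 :=
  Nat.size_le.2 (h.trans_lt (Nat.pow_lt_pow_right one_lt_two k.lt_succ_self))

theorem natSize_le_of_le {a k L : ℕ} (h : a ≤ 2 ^ k) (hk : k ≤ L) : Nat.size a ≤ L + 1 :=
  (natSize_le_of_le_two_pow h).trans (by omega)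

variable {sz : R → ℕ} {K : ℕ} {V : ℕ → R → Prop}

theorem Mem.Level.mono (hV : Filtration sz K V) {j k : ℕ} (h : j ≤ k) {s : Mem R}
    (hs : s.Level V j) : s.Level V k :=
  ⟨fun x => (hs.ireg x).trans (Nat.pow_le_pow_right two_pos h),
    fun a t => (hs.iarr a t).trans (Nat.pow_le_pow_right two_pos h),
    fun x => hV.mono h (hs.vreg x), fun a t => hV.mono h (hs.varr a t)⟩

/-- A sum at most doubles the larger operand, so each node adds at most one to the exponent; a
truncated difference adds nothing, and an array read falls back to the level of the memory. -/
theorem IExp.eval_le {k : ℕ} {s : Mem R} (hs : s.Level V k) (e : IExp) :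
    e.eval s ≤ 2 ^ (k + e.nodes) := by
  induction e with
  | const c =>
    -- A constant counts `1 + c` nodes so that `c ≤ 2 ^ c` is enough here.
    exact (Nat.lt_two_pow_self (n := c)).le.trans
      (Nat.pow_le_pow_right two_pos (by simp only [nodes]; omega))
  | reg x => exact (hs.ireg x).trans (Nat.pow_le_pow_right two_pos (by omega))
  | arr a e ih => exact (hs.iarr a _).trans (Nat.pow_le_pow_right two_pos (by omega))
  | add e f ihe ihf =>
    have h₁ : 2 ^ (k + e.nodes) ≤ 2 ^ (k + e.nodes + f.nodes) :=
      Nat.pow_le_pow_right two_pos (by omega)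
    have h₂ : 2 ^ (k + f.nodes) ≤ 2 ^ (k + e.nodes + f.nodes) :=
      Nat.pow_le_pow_right two_pos (by omega)
    simp only [eval, nodes, ← add_assoc, pow_succ]
    omega
  | sub e f ihe ihf =>
    refine (Nat.sub_le _ _).trans (ihe.trans (Nat.pow_le_pow_right two_pos ?_))
    simp only [nodes]; omega

/-- `L` is a ceiling for all levels that occur, so a node costs one unit plus a binary length of at
most `L + 1`. -/
theorem IExp.cost_le {k L : ℕ} {s : Mem R} (hs : s.Level V k) (e : IExp) (hL : k + e.nodes ≤ L) :
    e.cost s ≤ e.nodes * (L + 2) := by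
  induction e with
  | const c =>
    have := natSize_le_of_le (IExp.eval_le hs (.const c)) hL
    simp only [eval] at this
    simp only [cost, nodes]
    nlinarith
  | reg x =>
    have := natSize_le_of_le (hs.ireg x) (by omega : k ≤ L)
    simp only [cost, nodes]
    omega
  | arr a e ih =>
    simp only [nodes] at hL
    have := natSize_le_of_le (hs.iarr a (e.eval s)) (by omega : k ≤ L)
    have := ih (by omega)
    simp only [cost, nodes, add_mul]
    omega
  | add e f ihe ihf =>
    have h := natSize_le_of_le (IExp.eval_le hs (.add e f)) hL
    simp only [nodes] at hL
    simp only [eval] at h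
    have := ihe (by omega)
    have := ihf (by omega)
    simp only [cost, nodes, add_mul]
    omega
  | sub e f ihe ihf =>
    have h := natSize_le_of_le (IExp.eval_le hs (.sub e f)) hL
    simp only [nodes] at hL
    simp only [eval] at h
    have := ihe (by omega)
    have := ihf (by omega)
    simp only [cost, nodes, add_mul]
    omega

theorem VExp.level_eval (hV : Filtration sz K V) {k : ℕ} {s : Mem R} (hs : s.Level V k)
    (e : VExp) : V (k + e.nodes) (e.eval s) := by
  induction e with
  | zero => exact hV.zero _
  | reg x => exact hV.mono (by omega) (hs.vreg x)
  | arr a e => exact hV.mono (by omega) (hs.varr a _)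
  | add e f ihe ihf =>
    refine hV.mono (j := k + e.nodes + f.nodes + 1) (by simp only [nodes]; omega) (hV.add ?_ ?_)
    · exact hV.mono (by omega) ihe
    · exact hV.mono (by omega) ihf
  | sub e f ihe ihf =>
    refine hV.mono (j := k + e.nodes + f.nodes + 1) (by simp only [nodes]; omega) (hV.sub ?_ ?_)
    · exact hV.mono (by omega) ihe
    · exact hV.mono (by omega) ihf

theorem VExp.cost_le (hV : Filtration sz K V) {k L : ℕ} {s : Mem R} (hs : s.Level V k) (e : VExp)
    (hL : k + e.nodes ≤ L) : e.cost sz s ≤ e.nodes * (K + L + 2) := by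
  have h := hV.size (VExp.level_eval hV hs e)
  induction e with
  | zero =>
    simp only [nodes, eval] at h hL
    simp only [cost, nodes]
    omega
  | reg x =>
    simp only [nodes, eval] at h hL
    simp only [cost, nodes]
    omega
  | arr a e =>
    simp only [nodes, eval] at h hL
    have := e.cost_le hs (L := K + L) (by omega)
    simp only [cost, nodes, add_mul]
    omega
  | add e f ihe ihf =>
    simp only [nodes, eval] at h hL
    have := ihe (by omega) (hV.size (VExp.level_eval hV hs e))
    have := ihf (by omega) (hV.size (VExp.level_eval hV hs f))
    simp only [cost, nodes, add_mul]
    omega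
  | sub e f ihe ihf =>
    simp only [nodes, eval] at h hL
    have := ihe (by omega) (hV.size (VExp.level_eval hV hs e))
    have := ihf (by omega) (hV.size (VExp.level_eval hV hs f))
    simp only [cost, nodes, add_mul]
    omega

theorem Test.cost_le (hV : Filtration sz K V) {k L : ℕ} {s : Mem R} (hs : s.Level V k) (t : Test)
    (hL : k + t.nodes ≤ L) : t.cost sz s ≤ t.nodes * (K + L + 2) := by
  cases t with
  | ilt e f =>
    simp only [nodes] at hL
    have := e.cost_le hs (L := K + L) (by omega)
    have := f.cost_le hs (L := K + L) (by omega)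
    simp only [cost, nodes, add_mul]
    omega
  | vlt e f =>
    simp only [nodes] at hL
    have := e.cost_le hV hs (L := L) (by omega)
    have := f.cost_le hV hs (L := L) (by omega)
    simp only [cost, nodes, add_mul]
    omega

/-- A program that meets its specification in few operations meets it at low cost. -/
theorem wp.exec (hV : Filtration sz K V) {N : ℕ} {P : Prog} {Q : Mem R → Prop} {k L : ℕ}
    {s : Mem R} (h : wp N P Q s) (hs : s.Level V k) (hL : k + P.ops N ≤ L) :
    ∃ c s', Exec sz P s c s' ∧ Q s' ∧ s'.Level V (k + P.ops N) ∧ c ≤ P.ops N * (K + L + 2) := by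
  induction P generalizing Q k s with
  | skip =>
    refine ⟨_, _, .skip s, h, hs.mono hV (by omega), ?_⟩
    simp only [Prog.ops]; omega
  | iset x e =>
    simp only [Prog.ops] at hL ⊢
    have hc := e.cost_le hs (L := K + L) (by omega)
    have h' := hs.mono hV (by omega : k ≤ k + (e.nodes + 1))
    refine ⟨_, _, .iset x e s, h, ⟨fun y => ?_, h'.iarr, h'.vreg, h'.varr⟩, ?_⟩
    · simp only [Mem.setIreg, Function.update_apply]
      split_ifs
      · exact (e.eval_le hs).trans (Nat.pow_le_pow_right two_pos (by omega))
      · exact h'.ireg y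
    · simp only [add_mul]; omega
  | vset x e =>
    simp only [Prog.ops] at hL ⊢
    have hc := e.cost_le hV hs (L := L) (by omega)
    have h' := hs.mono hV (by omega : k ≤ k + (e.nodes + 1))
    refine ⟨_, _, .vset x e s, h, ⟨h'.ireg, h'.iarr, fun y => ?_, h'.varr⟩, ?_⟩
    · simp only [Mem.setVreg, Function.update_apply]
      split_ifs
      · exact hV.mono (by omega) (e.level_eval hV hs)
      · exact h'.vreg y
    · simp only [add_mul]; omega
  | istore a e f =>
    simp only [Prog.ops] at hL ⊢
    have hc := e.cost_le hs (L := K + L) (by omega)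
    have hc' := f.cost_le hs (L := K + L) (by omega)
    have h' := hs.mono hV (by omega : k ≤ k + (e.nodes + f.nodes + 1))
    refine ⟨_, _, .istore a e f s, h, ⟨h'.ireg, fun b t => ?_, h'.vreg, h'.varr⟩, ?_⟩
    · simp only [Mem.setIarr, Function.update_apply]
      split_ifs with hb
      · rw [Function.update_apply]
        split_ifs
        · exact (f.eval_le hs).trans (Nat.pow_le_pow_right two_pos (by omega))
        · exact h'.iarr a t
      · exact h'.iarr b t
    · simp only [add_mul]; omega
  | vstore a e f =>
    simp only [Prog.ops] at hL ⊢
    have hc := e.cost_le hs (L := K + L) (by omega)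
    have hc' := f.cost_le hV hs (L := L) (by omega)
    have h' := hs.mono hV (by omega : k ≤ k + (e.nodes + f.nodes + 1))
    refine ⟨_, _, .vstore a e f s, h, ⟨h'.ireg, h'.iarr, h'.vreg, fun b t => ?_⟩, ?_⟩
    · simp only [Mem.setVarr, Function.update_apply]
      split_ifs with hb
      · rw [Function.update_apply]
        split_ifs
        · exact hV.mono (by omega) (f.level_eval hV hs)
        · exact h'.varr a t
      · exact h'.varr b t
    · simp only [add_mul]; omega
  | seq P P' ih ih' =>
    simp only [Prog.ops] at hL ⊢
    obtain ⟨c₁, s₁, e₁, h₁, l₁, b₁⟩ := ih h hs (by omega)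
    obtain ⟨c₂, s₂, e₂, h₂, l₂, b₂⟩ := ih' h₁ l₁ (by omega)
    refine ⟨_, _, .seq e₁ e₂, h₂, l₂.mono hV (by omega), ?_⟩
    rw [add_mul]; omega
  | branch t P P' ih ih' =>
    simp only [Prog.ops] at hL ⊢
    have hc := t.cost_le hV hs (L := L) (by omega)
    by_cases ht : t.Holds s
    · obtain ⟨c₁, s₁, e₁, h₁, l₁, b₁⟩ := ih (h.1 ht) hs (by omega)
      refine ⟨_, _, .branch_true ht e₁, h₁, l₁.mono hV (by omega), ?_⟩
      simp only [add_mul]; omega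
    · obtain ⟨c₁, s₁, e₁, h₁, l₁, b₁⟩ := ih' (h.2 ht) hs (by omega)
      refine ⟨_, _, .branch_false ht e₁, h₁, l₁.mono hV (by omega), ?_⟩
      simp only [add_mul]; omega
  | loop t P ih =>
    simp only [Prog.ops] at hL ⊢
    -- The starting level `k` has to vary, since every iteration raises it. With `j` iterations
    -- left, `j + 1` tests are budgeted: the last one fails.
    suffices H : ∀ (j k : ℕ) (s : Mem R), loopWp t (wp N P) Q j s → s.Level V k →
        k + (j + 1) * (t.nodes + P.ops N) ≤ L →
        ∃ c s', Exec sz (.loop t P) s c s' ∧ Q s' ∧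
          s'.Level V (k + (j + 1) * (t.nodes + P.ops N)) ∧
          c ≤ (j + 1) * (t.nodes + P.ops N) * (K + L + 2) from H N k s h hs hL
    have halt : ∀ (j k : ℕ) (s : Mem R), ¬ t.Holds s → Q s → s.Level V k →
        k + (j + 1) * (t.nodes + P.ops N) ≤ L →
        ∃ c s', Exec sz (.loop t P) s c s' ∧ Q s' ∧
          s'.Level V (k + (j + 1) * (t.nodes + P.ops N)) ∧
          c ≤ (j + 1) * (t.nodes + P.ops N) * (K + L + 2) := by
      intro j k s ht hq hs hL
      have hle : t.nodes ≤ (j + 1) * (t.nodes + P.ops N) := by nlinarith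
      exact ⟨_, _, .loop_false ht, hq, hs.mono hV (by omega),
        (t.cost_le hV hs (by omega)).trans (Nat.mul_le_mul_right _ hle)⟩
    intro j
    induction j with
    | zero => exact fun k s h => halt 0 k s h.1 h.2
    | succ j ihj =>
      intro k s h hs hL
      by_cases ht : t.Holds s
      · have hexp : (j + 1 + 1) * (t.nodes + P.ops N) =
            (j + 1) * (t.nodes + P.ops N) + (t.nodes + P.ops N) := by ring
        rw [hexp] at hL ⊢
        have hc := t.cost_le hV hs (L := L) (by omega)
        obtain ⟨c₁, s₁, e₁, h₁, l₁, b₁⟩ := ih (h.2 ht) hs (by omega)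
        obtain ⟨c₂, s₂, e₂, h₂, l₂, b₂⟩ := ihj _ s₁ h₁ l₁ (by omega)
        refine ⟨_, _, .loop_true ht e₁ e₂, h₂, l₂.mono hV (by omega), ?_⟩
        rw [add_mul ((j + 1) * _), add_mul t.nodes]
        omega
      · exact halt (j + 1) k s ht (h.1 ht) hs hL

/-- The operation count is polynomial in the bound for the loops. -/
theorem Prog.exists_polynomial_ops (P : Prog) :
    ∃ p : Polynomial ℕ, ∀ N, P.ops N = p.eval N := by
  induction P with
  | skip => exact ⟨1, by simp [ops]⟩
  | iset x e => exact ⟨Polynomial.C (e.nodes + 1), fun N => Polynomial.eval_C.symm⟩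
  | vset x e => exact ⟨Polynomial.C (e.nodes + 1), fun N => Polynomial.eval_C.symm⟩
  | istore a e f =>
    exact ⟨Polynomial.C (e.nodes + f.nodes + 1), fun N => Polynomial.eval_C.symm⟩
  | vstore a e f =>
    exact ⟨Polynomial.C (e.nodes + f.nodes + 1), fun N => Polynomial.eval_C.symm⟩
  | seq P P' ih ih' =>
    obtain ⟨p, hp⟩ := ih
    obtain ⟨p', hp'⟩ := ih'
    exact ⟨p + p', fun N => by simp [ops, hp, hp']⟩
  | branch t P P' ih ih' =>
    obtain ⟨p, hp⟩ := ih
    obtain ⟨p', hp'⟩ := ih'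
    exact ⟨Polynomial.C t.nodes + p + p', fun N => by simp [ops, hp, hp']⟩
  | loop t P ih =>
    obtain ⟨p, hp⟩ := ih
    exact ⟨(Polynomial.X + 1) * (Polynomial.C t.nodes + p), fun N => by simp [ops, hp]⟩

end Cost

end RAM

/-! ## The Hungarian method -/

section Hungarian

variable {R : Type} [AddCommGroup R] [LinearOrder R] [IsOrderedAddMonoid R]

/-- State of the Hungarian method for the cost matrix `c` of order `N`, while the row `k` is being
added: `u` and `v` are potentials, `S` is the set of rows and `T` the set of columns of the
alternating tree with root `k`, and for every `i` in `S`, `M i` is a permutation that is tight on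
all rows up to `k` except `i`. -/
structure HungarianState (N : ℕ) (c : ℕ → ℕ → R) (u v : ℕ → R) (k : ℕ) (S T : ℕ → Prop)
    (M : ℕ → ℕ → ℕ) : Prop where
  root : S k
  le_root : ∀ i, S i → i ≤ k
  feas : ∀ i < N, ∀ j < N, u i + v j ≤ c i j
  maps : ∀ i, S i → ∀ x < N, M i x < N
  inj : ∀ i, S i → ∀ x < N, ∀ y < N, M i x = M i y → x = y
  tight : ∀ i, S i → ∀ x < N, x ≤ k → x ≠ i → u x + v (M i x) = c x (M i x)
  hole : ∀ i, S i → M i i = M k k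
  hole_notMem : k < N → ¬ T (M k k)
  mem_iff : ∀ i, S i → ∀ x < N, x ≠ i → (T (M i x) ↔ S x)
  agree : ∀ i, S i → ∀ x < N, ¬ S x → M i x = M k x

namespace HungarianState

variable {N : ℕ} {c : ℕ → ℕ → R} {u v : ℕ → R} {k : ℕ} {S T : ℕ → Prop} {M : ℕ → ℕ → ℕ}

/-- Nonnegative costs make zero potentials feasible. With root `0`, the only row up to the root is
the exempt one, so tightness asks nothing and the identity will do. -/
theorem init (hc : ∀ i < N, ∀ j < N, 0 ≤ c i j) (hu : ∀ i < N, u i = 0)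
    (hv : ∀ j < N, v j = 0) (hS : ∀ i, S i ↔ i = 0) (hT : ∀ j, ¬ T j)
    (hM : ∀ x < N, M 0 x = x) : HungarianState N c u v 0 S T M where
  root := (hS 0).2 rfl
  le_root i hi := ((hS i).1 hi).le
  feas i hi j hj := by rw [hu i hi, hv j hj, add_zero]; exact hc i hi j hj
  maps i hi x hx := by rwa [(hS i).1 hi, hM x hx]
  inj i hi x hx y hy h := by rwa [(hS i).1 hi, hM x hx, hM y hy] at h
  tight i hi x hx hx' hne := absurd ((hS i).1 hi) (by omega)
  hole i hi := by rw [(hS i).1 hi]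
  hole_notMem _ := hT _
  mem_iff i hi x hx hne := ⟨fun h => (hT _ h).elim,
    fun h => (hne (((hS x).1 h).trans ((hS i).1 hi).symm)).elim⟩
  agree i hi x hx _ := by rw [(hS i).1 hi]

/-- Changing the potentials by the least slack `δ` between the tree and its outside. -/
theorem shift (h : HungarianState N c u v k S T M) {δ : R} (hδ : 0 ≤ δ)
    (hmin : ∀ i < N, ∀ j < N, S i → ¬ T j → δ ≤ c i j - u i - v j) {u' v' : ℕ → R}
    (hu : ∀ i < N, S i → u' i = u i + δ) (hu' : ∀ i < N, ¬ S i → u' i = u i)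
    (hv : ∀ j < N, T j → v' j = v j - δ) (hv' : ∀ j < N, ¬ T j → v' j = v j) :
    HungarianState N c u' v' k S T M where
  root := h.root
  le_root := h.le_root
  feas i hi j hj := by
    have := h.feas i hi j hj
    -- Only a row inside the tree with a column outside gets a larger sum of potentials, and there
    -- `δ` is at most the slack.
    by_cases hS : S i <;> by_cases hT : T j
    · rw [hu i hi hS, hv j hj hT]
      exact le_of_eq_of_le (by abel) this
    · rw [hu i hi hS, hv' j hj hT]
      have := hmin i hi j hj hS hT
      rw [sub_sub, le_sub_iff_add_le] at this
      exact le_of_eq_of_le (by abel) this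
    · rw [hu' i hi hS, hv j hj hT]
      refine le_trans ?_ this
      rw [← add_sub_assoc]
      exact sub_le_self _ hδ
    · rwa [hu' i hi hS, hv' j hj hT]
  maps := h.maps
  inj := h.inj
  tight i hi x hx hxk hne := by
    have hj := h.maps i hi x hx
    rw [← h.tight i hi x hx hxk hne]
    -- By `mem_iff` the edge of `M i` at `x` has both ends in the tree or none, so the two changes
    -- cancel.
    by_cases hS : S x
    · rw [hu x hx hS, hv _ hj ((h.mem_iff i hi x hx hne).2 hS)]
      abel
    · rw [hu' x hx hS, hv' _ hj (mt (h.mem_iff i hi x hx hne).1 hS)]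
  hole := h.hole
  hole_notMem := h.hole_notMem
  mem_iff := h.mem_iff
  agree := h.agree

theorem exists_eq (h : HungarianState N c u v k S T M) {i : ℕ} (hi : S i) {j : ℕ} (hj : j < N) :
    ∃ r < N, M i r = j := by
  obtain ⟨r, hr, e⟩ := Finset.surj_on_of_inj_on_of_card_le (s := Finset.range N)
    (t := Finset.range N) (fun x _ => M i x)
    (fun x hx => Finset.mem_range.2 (h.maps i hi x (Finset.mem_range.1 hx)))
    (fun x y hx hy => h.inj i hi x (Finset.mem_range.1 hx) y (Finset.mem_range.1 hy)) le_rfl j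
    (Finset.mem_range.2 hj)
  exact ⟨r, Finset.mem_range.1 hr, e.symm⟩

variable {S' T' : ℕ → Prop} {M' : ℕ → ℕ → ℕ} {i₀ j₀ r : ℕ}

section Swap

variable {p p' : ℕ → ℕ} {f : ℕ}

/-- `p'` is `p` followed by the transposition of the columns `j₀` and `f`. -/
theorem swap_maps (hp : ∀ x < N, p x < N) (hj : j₀ < N) (hf : f < N)
    (hp' : ∀ x < N, p' x = if p x = j₀ then f else if p x = f then j₀ else p x) :
    ∀ x < N, p' x < N := by
  intro x hx
  rw [hp' x hx]
  have := hp x hx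
  split_ifs <;> assumption

theorem swap_inj (hp : ∀ x < N, ∀ y < N, p x = p y → x = y)
    (hp' : ∀ x < N, p' x = if p x = j₀ then f else if p x = f then j₀ else p x) :
    ∀ x < N, ∀ y < N, p' x = p' y → x = y := by
  intro x hx y hy h
  rw [hp' x hx, hp' y hy] at h
  exact hp x hx y hy (by split_ifs at h <;> omega)

end Swap

/-- Extending the tree along a tight edge to a column that is matched to a row below the root. -/
theorem extend (h : HungarianState N c u v k S T M) (hk : k < N) (hi : S i₀) (hj : j₀ < N)
    (hjT : ¬ T j₀) (htight : u i₀ + v j₀ = c i₀ j₀) (hr : r < N) (hrj : M i₀ r = j₀)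
    (hne : j₀ ≠ M i₀ i₀) (hrk : r ≤ k) (hS : ∀ i, S' i ↔ i = r ∨ S i)
    (hT : ∀ j, T' j ↔ j = j₀ ∨ T j) (hM : ∀ i, S i → ∀ x < N, M' i x = M i x)
    (hMr : ∀ x < N, M' r x =
      if M i₀ x = j₀ then M i₀ i₀ else if M i₀ x = M i₀ i₀ then j₀ else M i₀ x) :
    ¬ S r ∧ HungarianState N c u v k S' T' M' := by
  have hi₀N : i₀ < N := (h.le_root _ hi).trans_lt hk
  have hri : r ≠ i₀ := by rintro rfl; exact hne hrj.symm
  have hrS : ¬ S r := fun hr' => hjT (hrj ▸ (h.mem_iff i₀ hi r hr hri).2 hr')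
  have hMk := hM k h.root
  have hole₀ : ¬ T (M i₀ i₀) := by rw [h.hole i₀ hi]; exact h.hole_notMem hk
  -- The new permutation differs from `M i₀` in two rows only: `i₀` receives the tight column `j₀`,
  -- and `r` receives the hole.
  have hfar : ∀ x < N, x ≠ r → x ≠ i₀ → M' r x = M i₀ x := by
    intro x hx hxr hxi
    rw [hMr x hx, if_neg, if_neg]
    · exact fun e => hxi (h.inj i₀ hi x hx i₀ hi₀N e)
    · exact fun e => hxr (h.inj i₀ hi x hx r hr (e.trans hrj.symm))
  have hat : M' r i₀ = j₀ := by rw [hMr i₀ hi₀N, if_neg hne.symm, if_pos rfl]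
  have hrr : M' r r = M i₀ i₀ := by rw [hMr r hr, if_pos hrj]
  have hlt : ∀ i, S i → i < N := fun i hi => (h.le_root i hi).trans_lt hk
  -- All permutations of the tree agree on rows outside it, so each of them sends `r` to `j₀`, and
  -- by injectivity no other row.
  have hnej : ∀ i, S i → ∀ x < N, x ≠ r → M i x ≠ j₀ := by
    intro i hi' x hx hxr e
    refine hxr (h.inj i hi' x hx r hr ?_)
    rw [e, h.agree i hi' r hr hrS, ← h.agree i₀ hi r hr hrS, hrj]
  refine ⟨hrS, ⟨(hS k).2 (.inr h.root), ?_, h.feas, ?_, ?_, ?_, ?_, ?_, ?_, ?_⟩⟩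
  · intro i hi'
    rcases (hS i).1 hi' with rfl | hi'
    · exact hrk
    · exact h.le_root i hi'
  · intro i hi'
    rcases (hS i).1 hi' with rfl | hi'
    · exact swap_maps (h.maps i₀ hi) hj (h.maps i₀ hi i₀ hi₀N) hMr
    · intro x hx
      rw [hM i hi' x hx]
      exact h.maps i hi' x hx
  · intro i hi'
    rcases (hS i).1 hi' with rfl | hi'
    · exact swap_inj (h.inj i₀ hi) hMr
    · intro x hx y hy
      rw [hM i hi' x hx, hM i hi' y hy]
      exact h.inj i hi' x hx y hy
  · intro i hi' x hx hxk hxi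
    rcases (hS i).1 hi' with rfl | hi'
    · by_cases hx₀ : x = i₀
      · rw [hx₀, hat, htight]
      · rw [hfar x hx hxi hx₀]
        exact h.tight i₀ hi x hx hxk hx₀
    · rw [hM i hi' x hx]
      exact h.tight i hi' x hx hxk hxi
  · intro i hi'
    rw [hMk k hk]
    rcases (hS i).1 hi' with rfl | hi'
    · rw [hrr, h.hole i₀ hi]
    · rw [hM i hi' i (hlt i hi'), h.hole i hi']
  · intro _
    rw [hMk k hk, hT, ← h.hole i₀ hi]
    rintro (e | e)
    · exact hne e.symm
    · exact hole₀ e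
  · intro i hi' x hx hxi
    rw [hT, hS]
    rcases (hS i).1 hi' with rfl | hi'
    · by_cases hx₀ : x = i₀
      · rw [hx₀, hat]
        exact ⟨fun _ => .inr hi, fun _ => .inl rfl⟩
      · rw [hfar x hx hxi hx₀, h.mem_iff i₀ hi x hx hx₀]
        simp only [hnej i₀ hi x hx hxi, hxi]
    · rw [hM i hi' x hx, h.mem_iff i hi' x hx hxi]
      by_cases hxr : x = r
      · have : M i x = j₀ := by
          rw [hxr, h.agree i hi' r hr hrS, ← h.agree i₀ hi r hr hrS, hrj]
        exact ⟨fun _ => .inl hxr, fun _ => .inl this⟩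
      · simp only [hnej i hi' x hx hxr, hxr]
  · intro i hi' x hx hxS
    rw [hS, not_or] at hxS
    rw [hMk x hx]
    rcases (hS i).1 hi' with rfl | hi'
    · rw [hfar x hx hxS.1 (by rintro rfl; exact hxS.2 hi), h.agree i₀ hi x hx hxS.2]
    · rw [hM i hi' x hx, h.agree i hi' x hx hxS.2]

/-- Augmenting along a tight edge to a free column, and starting with the next row. -/
theorem augment (h : HungarianState N c u v k S T M) (hk : k < N) (hi : S i₀) (hj : j₀ < N)
    (htight : u i₀ + v j₀ = c i₀ j₀) (hr : r < N) (hrj : M i₀ r = j₀)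
    (hfree : j₀ = M i₀ i₀ ∨ k < r) (hS : ∀ i, S' i ↔ i = k + 1) (hT : ∀ j, ¬ T' j)
    (hM : ∀ x < N, M' (k + 1) x =
      if M i₀ x = j₀ then M i₀ i₀ else if M i₀ x = M i₀ i₀ then j₀ else M i₀ x) :
    HungarianState N c u v (k + 1) S' T' M' where
  root := (hS _).2 rfl
  le_root i hi := ((hS i).1 hi).le
  feas := h.feas
  maps i hi' := by
    rw [(hS i).1 hi']
    exact swap_maps (h.maps i₀ hi) hj (h.maps i₀ hi i₀ ((h.le_root _ hi).trans_lt hk)) hM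
  inj i hi' := by
    rw [(hS i).1 hi']
    exact swap_inj (h.inj i₀ hi) hM
  tight i hi' x hx hxk hxi := by
    have hi₀N : i₀ < N := (h.le_root _ hi).trans_lt hk
    rw [(hS i).1 hi'] at hxi ⊢
    by_cases hx₀ : x = i₀
    · have : M' (k + 1) i₀ = j₀ := by
        rw [hM i₀ hi₀N, if_pos rfl]
        split_ifs with e
        · exact e
        · rfl
      rw [hx₀, this, htight]
    · have : M' (k + 1) x = M i₀ x := by
        rw [hM x hx]
        have h₁ : M i₀ x ≠ M i₀ i₀ := fun e => hx₀ (h.inj i₀ hi x hx i₀ hi₀N e)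
        rw [if_neg h₁, if_neg]
        rintro e
        -- A row other than `i₀` loses its column only if it is `r`; then `j₀` is not the hole,
        -- hence `r` exceeds `k` and its tightness is not yet required.
        rcases hfree with e' | hlt
        · exact h₁ (e.trans e')
        · have := h.inj i₀ hi x hx r hr (e.trans hrj.symm)
          omega
      rw [this]
      exact h.tight i₀ hi x hx (by omega) hx₀
  hole i hi := by rw [(hS i).1 hi]
  hole_notMem _ := hT _
  mem_iff i hi x hx hne := ⟨fun h => (hT _ h).elim,
    fun h => (hne (((hS x).1 h).trans ((hS i).1 hi).symm)).elim⟩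
  agree i hi x hx _ := by rw [(hS i).1 hi]

/-- In the end, the least cost of a permutation is the sum of the potentials. -/
theorem inf'_eq (h : HungarianState N c u v N S T M) :
    (Finset.univ.inf' Finset.univ_nonempty fun σ : Equiv.Perm (Fin N) => ∑ i : Fin N, c i (σ i)) =
      ∑ x ∈ Finset.range N, (u x + v x) := by
  -- Reindexing the column potentials shows that their total does not depend on the permutation.
  have hperm : ∀ σ : Equiv.Perm (Fin N), ∑ i : Fin N, (u i + v (σ i)) =
      ∑ x ∈ Finset.range N, (u x + v x) := by
    intro σ
    rw [Finset.sum_range, Finset.sum_add_distrib, Finset.sum_add_distrib]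
    exact congrArg _ (Equiv.sum_comp σ fun x : Fin N => v x)
  apply le_antisymm
  · have hinj : Function.Injective fun x : Fin N => (⟨M N x, h.maps N h.root x x.2⟩ : Fin N) := by
      intro x y hxy
      exact Fin.ext (h.inj N h.root x x.2 y y.2 (congrArg Fin.val hxy))
    refine (Finset.inf'_le _ (Finset.mem_univ
      (Equiv.ofBijective _ (Finite.injective_iff_bijective.1 hinj)))).trans ?_
    rw [← hperm (Equiv.ofBijective _ (Finite.injective_iff_bijective.1 hinj))]
    exact Finset.sum_le_sum fun x _ =>
      (h.tight N h.root x x.2 x.2.le x.2.ne).ge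
  · refine Finset.le_inf' _ _ fun σ _ => ?_
    rw [← hperm σ]
    exact Finset.sum_le_sum fun x _ => h.feas x x.2 _ (σ x).2

end HungarianState

end Hungarian

namespace RAM

/-! ## The program

Integer registers: `2` order `N` of the cost matrix, `3` root `k`, `4`, `5` and `11` loop counters,
`6`, `7` row and column of least slack, `8` row matched to that column, `9` row of the table to be
written, `10` column that the table leaves free. Value registers: `0` threshold, `1` least slack,
`2` sum, `3` difference. Integer arrays: `0` given permutation, `1` multiples of `N`, `2` and `3`
tree (`x` is in the tree if the entry exceeds `k`), `4` tables of the permutations, `5` multiples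
of the row length of the input. Value arrays: `0`, `1` input matrices, `2` cost matrix, `3`, `4`
potentials. -/

/-- Address of the entry `(e, f)` of an `N × N` matrix. -/
abbrev idx (e f : IExp) : IExp := .add (.arr 1 e) f

/-- Slack of the entry `(e, f)`. -/
abbrev slackExp (e f : IExp) : VExp := .sub (.sub (.arr 2 (idx e f)) (.arr 3 e)) (.arr 4 f)

/-- The test `e ≠ f`. -/
abbrev neTest (e f : IExp) : Test := .ilt (.const 0) (.add (.sub e f) (.sub f e))

/-- Write the multiples of `e` up to `n * e` to the array `a`. -/
def multiples (a : ℕ) (n e : IExp) : Prog :=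
  forLoop 11 n (.istore a (.add (.reg 11) (.const 1)) (.add (.arr a (.reg 11)) e))

/-- Find the least slack between rows in the tree and columns outside. -/
def search : Prog :=
  .seq (.iset 6 (.reg 3)) <| .seq (.iset 7 (.arr 4 (idx (.reg 3) (.reg 3)))) <|
  .seq (.vset 1 (slackExp (.reg 6) (.reg 7))) <|
  forLoop 4 (.reg 2) <| .branch (.ilt (.reg 3) (.arr 2 (.reg 4)))
    (forLoop 5 (.reg 2) <| .branch (.ilt (.reg 3) (.arr 3 (.reg 5))) .skip <|
      .branch (.vlt (slackExp (.reg 4) (.reg 5)) (.reg 1))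
        (.seq (.iset 6 (.reg 4)) <| .seq (.iset 7 (.reg 5)) <|
          .vset 1 (slackExp (.reg 4) (.reg 5)))
        .skip)
    .skip

/-- Change the potentials by the least slack. -/
def shift : Prog :=
  forLoop 4 (.reg 2) <|
    .seq (.branch (.ilt (.reg 3) (.arr 2 (.reg 4)))
      (.vstore 3 (.reg 4) (.add (.arr 3 (.reg 4)) (.reg 1))) .skip) <|
    .branch (.ilt (.reg 3) (.arr 3 (.reg 4)))
      (.vstore 4 (.reg 4) (.sub (.arr 4 (.reg 4)) (.reg 1))) .skip

/-- Find the row that is matched to the column of least slack. -/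
def findRow : Prog :=
  .seq (.iset 10 (.arr 4 (idx (.reg 6) (.reg 6)))) <|
  forLoop 11 (.reg 2) <|
    .branch (neTest (.arr 4 (idx (.reg 6) (.reg 11))) (.reg 7)) .skip (.iset 8 (.reg 11))

/-- Start with the next row. -/
def nextRow : Prog :=
  .seq (.iset 3 (.add (.reg 3) (.const 1))) <| .seq (.iset 9 (.reg 3)) <|
  .istore 2 (.reg 3) (.add (.reg 3) (.const 1))

/-- Extend the tree. -/
def growTree : Prog :=
  .seq (.iset 9 (.reg 8)) <| .seq (.istore 2 (.reg 8) (.add (.reg 3) (.const 1))) <|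
  .istore 3 (.reg 7) (.add (.reg 3) (.const 1))

/-- Extend the tree, or start with the next row if a free column has been reached. -/
def advance : Prog :=
  .branch (.ilt (.reg 3) (.reg 8)) nextRow (.branch (neTest (.reg 7) (.reg 10)) growTree nextRow)

/-- Write the table of the new permutation. -/
def copyTable : Prog :=
  forLoop 11 (.reg 2) <|
    .branch (neTest (.arr 4 (idx (.reg 6) (.reg 11))) (.reg 7))
      (.branch (neTest (.arr 4 (idx (.reg 6) (.reg 11))) (.reg 10))
        (.istore 4 (idx (.reg 9) (.reg 11)) (.arr 4 (idx (.reg 6) (.reg 11))))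
        (.istore 4 (idx (.reg 9) (.reg 11)) (.reg 7)))
      (.istore 4 (idx (.reg 9) (.reg 11)) (.reg 10))

/-- One round of the Hungarian method. -/
def round : Prog := .seq search <| .seq shift <| .seq findRow <| .seq advance copyTable

/-- Given the order of a cost matrix and the multiples of the order, compute optimal potentials. -/
def hungarian : Prog :=
  .seq (forLoop 11 (.reg 2) (.istore 4 (.reg 11) (.reg 11))) <|
  .seq (.iset 3 (.const 0)) <| .seq (.istore 2 (.const 0) (.const 1)) <|
  .loop (.ilt (.reg 3) (.reg 2)) round

/-- Compare the sum of the potentials to the threshold. -/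
def compareSum : Prog :=
  .seq (.vset 2 .zero) <|
  .seq (forLoop 4 (.reg 2) (.vset 2 (.add (.reg 2) (.add (.arr 3 (.reg 4)) (.arr 4 (.reg 4)))))) <|
  .branch (.vlt (.reg 0) (.reg 2)) (.iset 0 (.const 0)) (.iset 0 (.const 1))

/-- Compute the matrix with entries `∑ l < n, |V₀[e] - V₁[f]|`, where the expressions `e` and `f`
use the registers `4` and `5` for the row and the column, and `11` for `l`. -/
def costMatrix (n e f : IExp) : Prog :=
  forLoop 4 (.reg 2) <| forLoop 5 (.reg 2) <| .seq (.vset 2 .zero) <|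
    .seq (forLoop 11 n <| .seq (.vset 3 (.sub (.arr 0 e) (.arr 1 f))) <|
      .branch (.vlt (.reg 3) .zero) (.vset 2 (.sub (.reg 2) (.reg 3)))
        (.vset 2 (.add (.reg 2) (.reg 3)))) <|
    .vstore 2 (idx (.reg 4) (.reg 5)) (.reg 2)

/-! ### Correctness of the subroutines. -/

section Specs

variable {R : Type} [AddCommGroup R] [LinearOrder R] [IsOrderedAddMonoid R] {L N : ℕ}

attribute [simp] Prog.Writes wp IExp.eval VExp.eval Test.Holds

theorem mul_add_inj {i j x y : ℕ} (hx : x < N) (hy : y < N) :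
    i * N + x = j * N + y ↔ i = j ∧ x = y := by
  refine ⟨fun h => ?_, fun h => by rw [h.1, h.2]⟩
  have h₁ : i = j := by
    have := congrArg (· / N) h
    simpa [Nat.add_div_of_dvd_right, Nat.mul_div_cancel _ (by omega : 0 < N),
      Nat.div_eq_of_lt hx, Nat.div_eq_of_lt hy] using this
  subst h₁
  exact ⟨rfl, by omega⟩

/-- One of the truncated differences vanishes and the other is the distance; this makes `neTest`
meaningful although the machine can only test `<`. -/
theorem sub_add_sub_pos {a b : ℕ} : 0 < a - b + (b - a) ↔ a ≠ b := by omega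

/-- Without multiplication, row offsets are tabulated by repeated addition. The last multiple is
included because the table of permutations has a row `N`, for the final root. -/
theorem wp_multiples {a n k : ℕ} {e f : IExp} {s : Mem R} (hn : n ≤ L) (h0 : s.iarr a 0 = 0)
    (he : ∀ s', Frame (multiples a e f) s s' → e.eval s' = n)
    (hf : ∀ s', Frame (multiples a e f) s s' → f.eval s' = k) :
    wp L (multiples a e f) (fun s' => ∀ i ≤ n, s'.iarr a i = i * k) s := by
  refine wp_forLoop_frame (fun i s' => ∀ j ≤ i, s'.iarr a j = j * k) hn (by simp) he ?_ ?_ ?_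
  · intro j hj
    simp [Nat.le_zero.1 hj, h0]
  · intro i s' hi hF hx hI j hj
    simp only [IExp.eval, hx, hf s' hF, iarr_setIreg, iarr_setIarr, hI i le_rfl, true_and]
    split_ifs with h
    · rw [h]; ring
    · exact hI j (by omega)
  · exact fun s' _ h => h

/-- The slacks of a memory. -/
def slack (N : ℕ) (s : Mem R) (i j : ℕ) : R := s.varr 2 (i * N + j) - s.varr 3 i - s.varr 4 j

/-- The registers hold an entry of least slack among the entries that satisfy `P`. -/
def IsLeast (N : ℕ) (s : Mem R) (P : ℕ → ℕ → Prop) (s' : Mem R) : Prop :=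
  (s'.ireg 6 < N ∧ s.ireg 3 < s.iarr 2 (s'.ireg 6) ∧ s'.ireg 7 < N ∧
    ¬ s.ireg 3 < s.iarr 3 (s'.ireg 7) ∧ s'.vreg 1 = slack N s (s'.ireg 6) (s'.ireg 7)) ∧
  ∀ i j, P i j → s.ireg 3 < s.iarr 2 i → ¬ s.ireg 3 < s.iarr 3 j → s'.vreg 1 ≤ slack N s i j

/-- The scan starts from the root and its hole, which form an admissible pair by the last three
hypotheses, so no infinite value is needed as an initial minimum. -/
theorem wp_search {s : Mem R} (hN : s.ireg 2 = N) (hL : N ≤ L)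
    (hb : ∀ i ≤ N, s.iarr 1 i = i * N) (hk : s.ireg 3 < N)
    (hS : s.ireg 3 < s.iarr 2 (s.ireg 3)) (hM : s.iarr 4 (s.ireg 3 * N + s.ireg 3) < N)
    (hT : ¬ s.ireg 3 < s.iarr 3 (s.iarr 4 (s.ireg 3 * N + s.ireg 3))) :
    wp L search (IsLeast N s fun i j => i < N ∧ j < N) s := by
  have hb₀ := hb _ hk.le
  simp only [search, wp]
  refine wp_forLoop_frame (fun i => IsLeast N s fun x j => x < i ∧ j < N) hL (by simp)
    (fun s' hF => ?_) ?_ ?_ ?_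
  · simpa [hN] using hF.ireg 2 (by simp)
  · refine ⟨?_, fun i j h => absurd h.1 (by omega)⟩
    simp only [slack, IExp.eval, VExp.eval, ireg_setIreg, ireg_setVreg, iarr_setIreg,
      vreg_setVreg, vreg_setIreg, varr_setIreg, if_true, reduceIte, Nat.reduceEqDiff, hb₀]
    exact ⟨hk, hS, hM, hT, trivial⟩
  · intro i s₁ hi hF hx hI
    have e2 : s₁.ireg 2 = N := by simpa [hN] using hF.ireg 2 (by simp)
    have e3 : s₁.ireg 3 = s.ireg 3 := by simpa using hF.ireg 3 (by simp)
    have ea : s₁.iarr = s.iarr := by funext a; simpa using hF.iarr a (by simp)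
    have ev : s₁.varr = s.varr := by funext a; simpa using hF.varr a (by simp)
    simp only [wp, Test.Holds, IExp.eval, hx, e3, ea]
    refine ⟨fun hSi => ?_, fun hSi => ⟨?_, ?_⟩⟩
    · refine wp_forLoop_frame
        -- The pairs seen so far are those lexicographically before `(i, j)`.
        (fun j => IsLeast N s fun x y => (x < i ∧ y < N) ∨ (x = i ∧ y < j)) hL (by simp)
        (fun s' hF => ?_) ?_ ?_ ?_
      · simpa [e2] using hF.ireg 2 (by simp)
      · exact ⟨by simpa using hI.1, fun x y h => by
          simpa using hI.2 x y (h.resolve_right (by omega))⟩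
      · intro j s₂ hj hF hy hI
        have f3 : s₂.ireg 3 = s.ireg 3 := by simpa [e3] using hF.ireg 3 (by simp)
        have f4 : s₂.ireg 4 = i := by simpa [hx] using hF.ireg 4 (by simp)
        have fa : s₂.iarr = s.iarr := by funext a; simpa [ea] using hF.iarr a (by simp)
        have fv : s₂.varr = s.varr := by funext a; simpa [ev] using hF.varr a (by simp)
        have hsl : (slackExp (.reg 4) (.reg 5)).eval s₂ = slack N s i j := by
          simp only [VExp.eval, IExp.eval, f4, hy, fa, fv, hb i hi.le, slack]
        simp only [wp, Test.Holds, hsl]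
        simp only [VExp.eval, IExp.eval, hy, f3, fa]
        refine ⟨fun hTj => ?_, fun hTj => ⟨fun hlt => ?_, fun hlt => ?_⟩⟩
        · refine ⟨by simpa using hI.1, fun x y h hx hy => ?_⟩
          have hne : y ≠ j := fun e => hy (e ▸ hTj)
          simpa using hI.2 x y (h.imp_right fun h => ⟨h.1, by omega⟩) hx hy
        · simp only [IsLeast, slack, ireg_setIreg, ireg_setVreg, iarr_setIreg, f4,
            vreg_setVreg, vreg_setIreg, varr_setIreg, reduceIte, Nat.reduceEqDiff, hy, fv, fa,
            hb i hi.le]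
          refine ⟨⟨hi, hSi, hj, hTj, trivial⟩, fun x y h hxS hyT => ?_⟩
          by_cases hxy : x = i ∧ y = j
          · rw [hxy.1, hxy.2]
          · exact hlt.le.trans (hI.2 x y (by omega) hxS hyT)
        · refine ⟨by simpa using hI.1, fun x y h hxS hyT => ?_⟩
          by_cases hxy : x = i ∧ y = j
          · simpa [hxy.1, hxy.2] using hlt
          · simpa using hI.2 x y (by omega) hxS hyT
      · intro s₂ _ hI
        exact ⟨by simpa using hI.1, fun x y h => by simpa using hI.2 x y (by omega)⟩
    · simpa using hI.1
    · intro x y h hxS hyT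
      have hne : x ≠ i := fun e => hSi (e ▸ hxS)
      simpa using hI.2 x y (by omega) hxS hyT
  · exact fun s₁ _ hI => hI

theorem wp_shift {s : Mem R} (hN : s.ireg 2 = N) (hL : N ≤ L) :
    wp L shift (fun s' =>
      (∀ x, s'.varr 3 x =
        if x < N ∧ s.ireg 3 < s.iarr 2 x then s.varr 3 x + s.vreg 1 else s.varr 3 x) ∧
      ∀ x, s'.varr 4 x =
        if x < N ∧ s.ireg 3 < s.iarr 3 x then s.varr 4 x - s.vreg 1 else s.varr 4 x) s := by
  refine wp_forLoop_frame (fun i s' => (∀ x, s'.varr 3 x =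
        if x < i ∧ s.ireg 3 < s.iarr 2 x then s.varr 3 x + s.vreg 1 else s.varr 3 x) ∧
      ∀ x, s'.varr 4 x =
        if x < i ∧ s.ireg 3 < s.iarr 3 x then s.varr 4 x - s.vreg 1 else s.varr 4 x) hL (by simp)
      (fun s' hF => ?_) (by simp) ?_ (fun _ _ h => h)
  · simpa [hN] using hF.ireg 2 (by simp)
  · intro i s₁ hi hF hx hI
    have e3 : s₁.ireg 3 = s.ireg 3 := by simpa using hF.ireg 3 (by simp)
    have ea : s₁.iarr = s.iarr := by funext a; simpa using hF.iarr a (by simp)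
    have ev : s₁.vreg = s.vreg := by funext a; simpa using hF.vreg a (by simp)
    have key : ∀ {p q : Prop} {x : ℕ}, x ≠ i → ((x < i + 1 ∧ p) ↔ (x < i ∧ p)) := by
      intro p q x hne
      exact and_congr_left fun _ => by omega
    have h3 := hI.1
    have h4 := hI.2
    simp only [wp, Test.Holds, IExp.eval, VExp.eval, hx, e3, ea, ev, varr_setVarr, varr_setIreg,
      iarr_setVarr, ireg_setVarr, vreg_setVarr, Nat.reduceEqDiff, false_and, true_and, reduceIte]
    refine ⟨fun hS => ⟨fun hT => ⟨fun x => ?_, fun x => ?_⟩, fun hT => ⟨fun x => ?_, fun x => ?_⟩⟩,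
      fun hS => ⟨fun hT => ⟨fun x => ?_, fun x => ?_⟩, fun hT => ⟨fun x => ?_, fun x => ?_⟩⟩⟩
    all_goals
      by_cases hxi : x = i
      · simp [hxi, h3, h4, hS, hT]
      · simp only [hxi, if_false, h3, h4]
        congr 1
        rw [Nat.lt_succ_iff_lt_or_eq]
        simp [hxi]

theorem wp_findRow {s : Mem R} (hN : s.ireg 2 = N) (hL : N ≤ L)
    (hb : ∀ i ≤ N, s.iarr 1 i = i * N) (h6 : s.ireg 6 < N) {r : ℕ} (hr : r < N)
    (hrj : ∀ x < N, s.iarr 4 (s.ireg 6 * N + x) = s.ireg 7 ↔ x = r) :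
    wp L findRow (fun s' => s'.ireg 8 = r ∧ s'.ireg 10 = s.iarr 4 (s.ireg 6 * N + s.ireg 6)) s := by
  have hb₀ := hb _ h6.le
  simp only [findRow, wp]
  -- Register `8` may hold a stale value until the counter has passed `r`.
  refine wp_forLoop_frame (fun i s' => (r < i → s'.ireg 8 = r) ∧
    s'.ireg 10 = s.iarr 4 (s.ireg 6 * N + s.ireg 6)) hL (by simp)
    (fun s' hF => ?_) ?_ ?_ (fun s' _ h => ⟨h.1 hr, h.2⟩)
  · simpa [hN] using hF.ireg 2 (by simp)
  · simp [hb₀]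
  · intro i s₁ hi hF hx hI
    have e6 : s₁.ireg 6 = s.ireg 6 := by simpa using hF.ireg 6 (by simp)
    have e7 : s₁.ireg 7 = s.ireg 7 := by simpa using hF.ireg 7 (by simp)
    have ea : s₁.iarr = s.iarr := by funext a; simpa using hF.iarr a (by simp)
    simp only [wp, Test.Holds, IExp.eval, hx, e6, e7, ea, hb₀, sub_add_sub_pos, not_not, ne_eq,
      hrj i hi]
    refine ⟨fun hne => ?_, fun heq => ?_⟩
    · simpa using ⟨fun h => hI.1 (by omega), hI.2⟩
    · simpa using ⟨fun _ => heq, hI.2⟩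

theorem wp_copyTable {s : Mem R} (hN : s.ireg 2 = N) (hL : N ≤ L)
    (hb : ∀ i ≤ N, s.iarr 1 i = i * N) (h6 : s.ireg 6 < N) (h9 : s.ireg 9 ≤ N)
    (hne : s.ireg 6 ≠ s.ireg 9) :
    wp L copyTable (fun s' => ∀ i, ∀ x < N, s'.iarr 4 (i * N + x) =
      if i = s.ireg 9 then
        if s.iarr 4 (s.ireg 6 * N + x) = s.ireg 7 then s.ireg 10
        else if s.iarr 4 (s.ireg 6 * N + x) = s.ireg 10 then s.ireg 7
        else s.iarr 4 (s.ireg 6 * N + x)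
      else s.iarr 4 (i * N + x)) s := by
  refine wp_forLoop_frame (fun t s' => ∀ i, ∀ x < N, s'.iarr 4 (i * N + x) =
      if i = s.ireg 9 ∧ x < t then
        if s.iarr 4 (s.ireg 6 * N + x) = s.ireg 7 then s.ireg 10
        else if s.iarr 4 (s.ireg 6 * N + x) = s.ireg 10 then s.ireg 7
        else s.iarr 4 (s.ireg 6 * N + x)
      else s.iarr 4 (i * N + x)) hL (by simp)
    (fun s' hF => ?_) (by simp) ?_ ?_
  · simpa [hN] using hF.ireg 2 (by simp)
  · intro t s₁ ht hF hx hI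
    have e6 : s₁.ireg 6 = s.ireg 6 := by simpa using hF.ireg 6 (by simp)
    have e7 : s₁.ireg 7 = s.ireg 7 := by simpa using hF.ireg 7 (by simp)
    have e9 : s₁.ireg 9 = s.ireg 9 := by simpa using hF.ireg 9 (by simp)
    have e10 : s₁.ireg 10 = s.ireg 10 := by simpa using hF.ireg 10 (by simp)
    have ea : s₁.iarr 1 = s.iarr 1 := by simpa using hF.iarr 1 (by simp)
    -- The row being read is not the row being written, so it still has its original contents.
    have hy : s₁.iarr 4 (s.ireg 6 * N + t) = s.iarr 4 (s.ireg 6 * N + t) := by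
      rw [hI _ t ht, if_neg (fun h => hne h.1)]
    simp only [wp, Test.Holds, IExp.eval, hx, e6, e7, e9, e10, ea, hb _ h6.le, hb _ h9, hy,
      sub_add_sub_pos, not_not, ne_eq, iarr_setIarr, iarr_setIreg, true_and]
    -- The three branches differ only in the stored value `w`, so the invariant is restored once for
    -- all of them.
    have key : ∀ w, w = (if s.iarr 4 (s.ireg 6 * N + t) = s.ireg 7 then s.ireg 10
        else if s.iarr 4 (s.ireg 6 * N + t) = s.ireg 10 then s.ireg 7
        else s.iarr 4 (s.ireg 6 * N + t)) → ∀ i, ∀ x < N,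
        (if i * N + x = s.ireg 9 * N + t then w else s₁.iarr 4 (i * N + x)) =
        if i = s.ireg 9 ∧ x < t + 1 then
          if s.iarr 4 (s.ireg 6 * N + x) = s.ireg 7 then s.ireg 10
          else if s.iarr 4 (s.ireg 6 * N + x) = s.ireg 10 then s.ireg 7
          else s.iarr 4 (s.ireg 6 * N + x)
        else s.iarr 4 (i * N + x) := by
      intro w hw i x hxN
      simp only [mul_add_inj hxN ht, hI i x hxN]
      by_cases hix : i = s.ireg 9 ∧ x = t
      · rw [if_pos hix, if_pos ⟨hix.1, by omega⟩, hix.2, hw]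
      · rw [if_neg hix]
        congr 1
        exact propext ⟨fun h => ⟨h.1, by omega⟩, fun h => ⟨h.1, by omega⟩⟩
    refine ⟨fun h₁ => ⟨fun h₂ => key _ ?_, fun h₂ => key _ ?_⟩, fun h₁ => key _ ?_⟩
    · rw [if_neg h₁, if_neg h₂]
    · rw [if_neg h₁, if_pos h₂]
    · rw [if_pos h₁]
  · intro s' _ hI i x hx
    rw [hI i x hx]
    simp [hx]

end Specs

end RAM

namespace RAM

/-! ### Correctness of a round, of the Hungarian method and of the cost matrix. -/

section Specs

variable {R : Type} [AddCommGroup R] [LinearOrder R] [IsOrderedAddMonoid R] {L N : ℕ}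

/-- The two alternatives match the case distinctions of `HungarianState.extend` and
`HungarianState.augment`. -/
theorem wp_advance {s : Mem R} :
    wp L advance (fun s' =>
      (s.ireg 8 ≤ s.ireg 3 ∧ s.ireg 7 ≠ s.ireg 10 ∧ s'.ireg 3 = s.ireg 3 ∧ s'.ireg 9 = s.ireg 8 ∧
        (∀ x, s'.iarr 2 x = if x = s.ireg 8 then s.ireg 3 + 1 else s.iarr 2 x) ∧
        ∀ x, s'.iarr 3 x = if x = s.ireg 7 then s.ireg 3 + 1 else s.iarr 3 x) ∨
      ((s.ireg 7 = s.ireg 10 ∨ s.ireg 3 < s.ireg 8) ∧ s'.ireg 3 = s.ireg 3 + 1 ∧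
        s'.ireg 9 = s.ireg 3 + 1 ∧
        (∀ x, s'.iarr 2 x = if x = s.ireg 3 + 1 then s.ireg 3 + 1 + 1 else s.iarr 2 x) ∧
        ∀ x, s'.iarr 3 x = s.iarr 3 x)) s := by
  simp only [advance, nextRow, growTree, wp, Test.Holds, IExp.eval, sub_add_sub_pos, not_not,
    ne_eq, ireg_setIreg, iarr_setIreg, ireg_setIarr, iarr_setIarr, Nat.reduceEqDiff, reduceIte,
    true_and, false_and]
  refine ⟨fun h => .inr ⟨.inr h, ?_⟩, fun h => ⟨fun h' => .inl ⟨not_lt.1 h, h', ?_⟩,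
    fun h' => .inr ⟨.inl h', ?_⟩⟩⟩ <;> simp

/-- Invariant of the Hungarian method. -/
structure Inv (N : ℕ) (c : ℕ → ℕ → R) (s : Mem R) : Prop where
  order : s.ireg 2 = N
  base : ∀ i ≤ N, s.iarr 1 i = i * N
  cost : ∀ i < N, ∀ j < N, s.varr 2 (i * N + j) = c i j
  state : HungarianState N c (s.varr 3) (s.varr 4) (s.ireg 3) (fun x => s.ireg 3 < s.iarr 2 x)
    (fun x => s.ireg 3 < s.iarr 3 x) (fun i x => s.iarr 4 (i * N + x))
  rows_le : ∀ x, s.iarr 2 x ≤ s.ireg 3 + 1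
  cols_le : ∀ x, s.iarr 3 x ≤ s.ireg 3 + 1
  root_le : s.ireg 3 ≤ N

/-- Variant of the Hungarian method. -/
def variant (N : ℕ) (s : Mem R) : ℕ :=
  (N - s.ireg 3) * (N + 1) + ((Finset.range N).filter fun x => ¬ s.ireg 3 < s.iarr 2 x).card

theorem variant_lt_of_grow {s s' : Mem R} {r : ℕ} (hr : r < N) (h3 : s'.ireg 3 = s.ireg 3)
    (h : ∀ x, s.ireg 3 < s'.iarr 2 x ↔ x = r ∨ s.ireg 3 < s.iarr 2 x)
    (hrS : ¬ s.ireg 3 < s.iarr 2 r) : variant N s' < variant N s := by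
  rw [variant, variant, h3]
  refine Nat.add_lt_add_left (Finset.card_lt_card ?_) _
  rw [Finset.ssubset_iff_of_subset]
  · exact ⟨r, by simpa [hr] using hrS, by simp [h]⟩
  · intro x
    simp only [Finset.mem_filter, h, not_or]
    exact fun hx => ⟨hx.1, hx.2.2⟩

/-- A new root releases `N + 1`, while the number of rows outside the tree can grow by at most `N`.
-/
theorem variant_lt_of_next {s s' : Mem R} (hk : s.ireg 3 < N) (h3 : s'.ireg 3 = s.ireg 3 + 1) :
    variant N s' < variant N s := by
  rw [variant, variant, h3]
  have h₁ : ((Finset.range N).filter fun x => ¬ s.ireg 3 + 1 < s'.iarr 2 x).card ≤ N :=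
    (Finset.card_filter_le _ _).trans (Finset.card_range N).le
  have h₂ : N - s.ireg 3 = (N - (s.ireg 3 + 1)) + 1 := by omega
  rw [h₂, add_mul]
  omega

theorem wp_round {c : ℕ → ℕ → R} {s : Mem R} (hI : Inv N c s) (hk : s.ireg 3 < N) (hL : N ≤ L) :
    wp L round (fun s' => Inv N c s' ∧ variant N s' < variant N s) s := by
  have H := hI.state
  have hroot := H.maps _ H.root
  simp only [round, wp]
  refine (wp_search hI.order hL hI.base hk H.root (hroot _ hk) (H.hole_notMem hk)).frame.imp
    fun s₁ ⟨⟨⟨h6, h6S, h7, h7T, hδ⟩, hmin⟩, F₁⟩ => ?_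
  have a2 : s₁.ireg 2 = N := (F₁.ireg 2 (by simp [search])).trans hI.order
  have a3 : s₁.ireg 3 = s.ireg 3 := F₁.ireg 3 (by simp [search])
  have aa : s₁.iarr = s.iarr := funext fun a => F₁.iarr a (by simp [search])
  have av : s₁.varr = s.varr := funext fun a => F₁.varr a (by simp [search])
  refine (wp_shift a2 hL).frame.imp fun s₂ ⟨⟨hu, hv⟩, F₂⟩ => ?_
  simp only [a3, aa, av] at hu hv
  have b2 : s₂.ireg 2 = N := (F₂.ireg 2 (by simp [shift])).trans a2
  have b3 : s₂.ireg 3 = s.ireg 3 := (F₂.ireg 3 (by simp [shift])).trans a3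
  have b6 : s₂.ireg 6 = s₁.ireg 6 := F₂.ireg 6 (by simp [shift])
  have b7 : s₂.ireg 7 = s₁.ireg 7 := F₂.ireg 7 (by simp [shift])
  have ba : s₂.iarr = s.iarr := (funext fun a => F₂.iarr a (by simp [shift])).trans aa
  have bv : s₂.varr 2 = s.varr 2 := (F₂.varr 2 (by simp [shift])).trans (congrFun av 2)
  have hslack : ∀ i < N, ∀ j < N, slack N s i j = c i j - s.varr 3 i - s.varr 4 j := by
    intro i hi j hj
    rw [slack, hI.cost i hi j hj]
  have H₂ : HungarianState N c (s₂.varr 3) (s₂.varr 4) (s.ireg 3)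
      (fun x => s.ireg 3 < s.iarr 2 x) (fun x => s.ireg 3 < s.iarr 3 x)
      (fun i x => s.iarr 4 (i * N + x)) := by
    refine H.shift (δ := s₁.vreg 1) ?_ ?_ ?_ ?_ ?_ ?_
    · rw [hδ, hslack _ h6 _ h7, sub_sub, sub_nonneg]
      exact H.feas _ h6 _ h7
    · intro i hi j hj hS hT
      rw [← hslack i hi j hj]
      exact hmin i j ⟨hi, hj⟩ hS hT
    · intro i hi hS
      rw [hu, if_pos ⟨hi, hS⟩]
    · intro i hi hS
      rw [hu, if_neg fun h => hS h.2]
    · intro j hj hT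
      rw [hv, if_pos ⟨hj, hT⟩]
    · intro j hj hT
      rw [hv, if_neg fun h => hT h.2]
  -- The row gains exactly the slack of this edge, and the column, being outside the tree, keeps its
  -- potential.
  have htight : s₂.varr 3 (s₁.ireg 6) + s₂.varr 4 (s₁.ireg 7) = c (s₁.ireg 6) (s₁.ireg 7) := by
    rw [hu, hv, if_pos ⟨h6, h6S⟩, if_neg fun h => h7T h.2, hδ, hslack _ h6 _ h7]
    abel
  obtain ⟨r, hr, hrj⟩ := H₂.exists_eq h6S h7
  have hwp := wp_findRow (s := s₂) (L := L) b2 hL (by rw [ba]; exact hI.base) (by rwa [b6]) hr (by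
    intro x hx
    rw [ba, b6, b7, ← hrj]
    exact ⟨fun h => H₂.inj _ h6S x hx r hr h, fun h => by rw [h]⟩)
  refine hwp.frame.imp fun s₃ ⟨⟨c8, c10⟩, F₃⟩ => ?_
  rw [ba, b6] at c10
  have c2 : s₃.ireg 2 = N := (F₃.ireg 2 (by simp [findRow])).trans b2
  have c3 : s₃.ireg 3 = s.ireg 3 := (F₃.ireg 3 (by simp [findRow])).trans b3
  have c6 : s₃.ireg 6 = s₁.ireg 6 := (F₃.ireg 6 (by simp [findRow])).trans b6
  have c7 : s₃.ireg 7 = s₁.ireg 7 := (F₃.ireg 7 (by simp [findRow])).trans b7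
  have ca : s₃.iarr = s.iarr := (funext fun a => F₃.iarr a (by simp [findRow])).trans ba
  have cv : s₃.varr = s₂.varr := funext fun a => F₃.varr a (by simp [findRow])
  refine (wp_advance (s := s₃)).frame.imp fun s₄ ⟨hadv, F₄⟩ => ?_
  rw [c3, c7, c8, c10, ca] at hadv
  have d2 : s₄.ireg 2 = N := (F₄.ireg 2 (by simp [advance, nextRow, growTree])).trans c2
  have d6 : s₄.ireg 6 = s₁.ireg 6 := (F₄.ireg 6 (by simp [advance, nextRow, growTree])).trans c6
  have d7 : s₄.ireg 7 = s₁.ireg 7 := (F₄.ireg 7 (by simp [advance, nextRow, growTree])).trans c7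
  have d10 : s₄.ireg 10 = s.iarr 4 (s₁.ireg 6 * N + s₁.ireg 6) :=
    (F₄.ireg 10 (by simp [advance, nextRow, growTree])).trans c10
  have da : s₄.iarr 1 = s.iarr 1 :=
    (F₄.iarr 1 (by simp [advance, nextRow, growTree])).trans (congrFun ca 1)
  have da4 : s₄.iarr 4 = s.iarr 4 :=
    (F₄.iarr 4 (by simp [advance, nextRow, growTree])).trans (congrFun ca 4)
  have dv : s₄.varr = s₂.varr :=
    (funext fun a => F₄.varr a (by simp [advance, nextRow, growTree])).trans cv
  have hle : s₁.ireg 6 ≤ s.ireg 3 := H₂.le_root _ h6S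
  have hne : s₁.ireg 7 ≠ s.iarr 4 (s₁.ireg 6 * N + s₁.ireg 6) → r ≠ s₁.ireg 6 := by
    rintro h rfl
    exact h hrj.symm
  -- The table is written to row `r ≠ i₀` when the tree grows, and to row `k + 1 > i₀` when a new
  -- root starts.
  have h9 : s₄.ireg 9 ≤ N ∧ s₁.ireg 6 ≠ s₄.ireg 9 := by
    rcases hadv with ⟨-, hj, -, e9, -⟩ | ⟨-, -, e9, -⟩
    · have := hne hj
      omega
    · omega
  refine (wp_copyTable d2 hL (by rw [da]; exact hI.base) (by rwa [d6]) h9.1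
    (by rw [d6]; exact h9.2)).frame.imp fun s₅ ⟨hM, F₅⟩ => ?_
  rw [d6, d7, d10, da4] at hM
  have e2 : s₅.ireg 2 = N := (F₅.ireg 2 (by simp [copyTable])).trans d2
  have e3 : s₅.ireg 3 = s₄.ireg 3 := F₅.ireg 3 (by simp [copyTable])
  have ea1 : s₅.iarr 1 = s.iarr 1 := (F₅.iarr 1 (by simp [copyTable])).trans da
  have ea2 : s₅.iarr 2 = s₄.iarr 2 := F₅.iarr 2 (by simp [copyTable])
  have ea3 : s₅.iarr 3 = s₄.iarr 3 := F₅.iarr 3 (by simp [copyTable])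
  have ev : s₅.varr = s₂.varr := (funext fun a => F₅.varr a (by simp [copyTable])).trans dv
  have hcost : ∀ i < N, ∀ j < N, s₅.varr 2 (i * N + j) = c i j := by
    rw [ev, bv]
    exact hI.cost
  have hbase : ∀ i ≤ N, s₅.iarr 1 i = i * N := by
    rw [ea1]
    exact hI.base
  rcases hadv with ⟨hrk, hj, k3, k9, k2, kc⟩ | ⟨hfree, k3, k9, k2, kc⟩
  · rw [k9] at hM
    have hS : ∀ x, s.ireg 3 < s₅.iarr 2 x ↔ x = r ∨ s.ireg 3 < s.iarr 2 x := by
      intro x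
      rw [ea2, k2]
      split_ifs with h <;> simp [h]
    have hT : ∀ x, s.ireg 3 < s₅.iarr 3 x ↔ x = s₁.ireg 7 ∨ s.ireg 3 < s.iarr 3 x := by
      intro x
      rw [ea3, kc]
      split_ifs with h <;> simp [h]
    have k3' : s₅.ireg 3 = s.ireg 3 := e3.trans k3
    have hrS : ¬ s.ireg 3 < s.iarr 2 r := fun h =>
      h7T (by have := (H₂.mem_iff _ h6S r hr (hne hj)).2 h; rwa [hrj] at this)
    have ext := H₂.extend (M' := fun i x => s₅.iarr 4 (i * N + x)) hk h6S h7 h7T htight hr hrj hj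
      hrk hS hT (fun i hi x hx => by
        have : i ≠ r := fun e => hrS (e ▸ hi)
        simp only [hM i x hx, if_neg this]) (fun x hx => by simp only [hM r x hx, if_true])
    refine ⟨⟨e2, hbase, hcost, ?_, ?_, ?_, ?_⟩, variant_lt_of_grow hr k3' hS hrS⟩
    · rw [k3', ev]
      exact ext.2
    · intro x
      rw [k3', ea2, k2]
      split_ifs
      · exact le_rfl
      · exact hI.rows_le x
    · intro x
      rw [k3', ea3, kc]
      split_ifs
      · exact le_rfl
      · exact hI.cols_le x
    · rw [k3']
      exact hI.root_le
  · rw [k9] at hM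
    have k3' : s₅.ireg 3 = s.ireg 3 + 1 := e3.trans k3
    -- Old marks are at most `k + 1`, so raising the root empties the tree without any clearing
    -- loop; only the new root carries the mark `k + 2`.
    have hS : ∀ x, s.ireg 3 + 1 < s₅.iarr 2 x ↔ x = s.ireg 3 + 1 := by
      intro x
      have := hI.rows_le x
      rw [ea2, k2]
      split_ifs with h
      · simp [h]
      · simp only [h, iff_false]; omega
    have hT : ∀ x, ¬ s.ireg 3 + 1 < s₅.iarr 3 x := by
      intro x
      have := hI.cols_le x
      rw [ea3, kc]
      omega
    refine ⟨⟨e2, hbase, hcost, ?_, ?_, ?_, ?_⟩, variant_lt_of_next hk k3'⟩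
    · rw [k3', ev]
      exact H₂.augment hk h6S h7 htight hr hrj hfree hS hT fun x hx => by
        simp only [hM _ x hx, if_true]
    · intro x
      have := hI.rows_le x
      rw [k3', ea2, k2]
      split_ifs <;> omega
    · intro x
      have := hI.cols_le x
      rw [k3', ea3, kc]
      omega
    · omega

/-- The Hungarian method computes potentials whose sum is the least cost of a permutation. -/
theorem wp_hungarian {c : ℕ → ℕ → R} {s : Mem R} (hN : s.ireg 2 = N) (hpos : 0 < N)
    (hL : (N + 1) * (N + 1) ≤ L) (hb : ∀ i ≤ N, s.iarr 1 i = i * N)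
    (hc : ∀ i < N, ∀ j < N, s.varr 2 (i * N + j) = c i j) (hc0 : ∀ i < N, ∀ j < N, 0 ≤ c i j)
    (hS : ∀ x, s.iarr 2 x = 0) (hT : ∀ x, s.iarr 3 x = 0) (hu : ∀ x, s.varr 3 x = 0)
    (hv : ∀ x, s.varr 4 x = 0) :
    wp L hungarian (fun s' => ∑ x ∈ Finset.range N, (s'.varr 3 x + s'.varr 4 x) =
      Finset.univ.inf' Finset.univ_nonempty
        fun σ : Equiv.Perm (Fin N) => ∑ i : Fin N, c i (σ i)) s := by
  have hLN : N ≤ L := by nlinarith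
  have htable : wp L (forLoop 11 (.reg 2) (.istore 4 (.reg 11) (.reg 11)))
      (fun s' => ∀ x < N, s'.iarr 4 x = x) s := by
    refine wp_forLoop_frame (fun i s' => ∀ x < i, s'.iarr 4 x = x) hLN (by simp)
      (fun s' hF => ?_) (by simp) ?_ (fun _ _ h => h)
    · simpa [hN] using hF.ireg 2 (by simp)
    · intro i s' hi hF hx hI x hxi
      simp only [IExp.eval, hx, iarr_setIreg, iarr_setIarr, true_and]
      split_ifs with h
      · exact h.symm
      · exact hI x (by omega)
  simp only [hungarian]
  rw [wp]
  refine htable.frame.imp fun s₁ ⟨h4, F⟩ => ?_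
  have a2 : s₁.ireg 2 = N := (F.ireg 2 (by simp)).trans hN
  have a1 : s₁.iarr 1 = s.iarr 1 := F.iarr 1 (by simp)
  have as : s₁.iarr 2 = s.iarr 2 := F.iarr 2 (by simp)
  have at' : s₁.iarr 3 = s.iarr 3 := F.iarr 3 (by simp)
  have av : s₁.varr = s.varr := funext fun a => F.varr a (by simp)
  rw [wp, wp, wp, wp]
  refine wp_loop (Inv N c) (variant N) ?_ ?_ ?_ ?_
  · intro s' hI ht
    exact wp_round hI (by simpa [hI.order] using ht) hLN
  · intro s' hI ht
    have hk : s'.ireg 3 = N := by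
      have := hI.root_le
      have : ¬ s'.ireg 3 < N := by simpa [hI.order] using ht
      omega
    have := hI.state
    rw [hk] at this
    exact this.inf'_eq.symm
  · refine ⟨by simpa using a2, ?_, ?_, ?_, ?_, ?_, ?_⟩
    · simpa [a1] using hb
    · simpa [av] using hc
    · refine HungarianState.init hc0 ?_ ?_ ?_ ?_ ?_
      · simpa [av] using fun i _ => hu i
      · simpa [av] using fun i _ => hv i
      · intro i
        by_cases h : i = 0 <;> simp [as, hS, h]
      · simp [at', hT]
      · simpa using h4
    · intro x
      simp only [IExp.eval, iarr_setIarr, iarr_setIreg, as, hS, ireg_setIarr, ireg_setIreg]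
      split_ifs <;> simp
    · simp [at', hT]
    · simp
  -- The initial variant is at most `N * (N + 1) + N`, which is below `(N + 1) * (N + 1)`.
  · have : ((Finset.range N).filter fun x => ¬ 0 < if x = 0 then 1 else s₁.iarr 2 x).card ≤ N :=
      (Finset.card_filter_le _ _).trans (Finset.card_range N).le
    simp only [variant, IExp.eval, ireg_setIarr, ireg_setIreg, iarr_setIarr, iarr_setIreg,
      reduceIte, true_and, Nat.sub_zero]
    nlinarith

theorem wp_compareSum {s : Mem R} (hN : s.ireg 2 = N) (hL : N ≤ L) :
    wp L compareSum (fun s' =>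
      (∑ x ∈ Finset.range N, (s.varr 3 x + s.varr 4 x) ≤ s.vreg 0 → s'.ireg 0 = 1) ∧
      (¬ ∑ x ∈ Finset.range N, (s.varr 3 x + s.varr 4 x) ≤ s.vreg 0 → s'.ireg 0 = 0)) s := by
  simp only [compareSum, wp]
  refine wp_forLoop_frame
    (fun i s' => s'.vreg 2 = ∑ x ∈ Finset.range i, (s.varr 3 x + s.varr 4 x)) hL (by simp)
    (fun s' hF => ?_) (by simp) ?_ ?_
  · simpa [hN] using hF.ireg 2 (by simp)
  · intro i s' hi hF hx hI
    have ev : s'.varr = s.varr := by funext a; simpa using hF.varr a (by simp)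
    simp [hx, hI, ev, Finset.sum_range_succ]
  · intro s' hF hI
    have e0 : s'.vreg 0 = s.vreg 0 := by simpa using hF.vreg 0 (by simp)
    simp only [Test.Holds, VExp.eval, IExp.eval, e0, hI, ireg_setIreg, reduceIte]
    exact ⟨fun h => ⟨fun h' => absurd h h'.not_gt, fun _ => trivial⟩,
      fun h => ⟨fun _ => trivial, fun h' => absurd (not_lt.1 h) h'⟩⟩

/-- `E` and `F` abstract the addressing, so that one proof covers both problems. The hypotheses on
the expressions range over all memories in the frame, as they are evaluated anew in each iteration.
-/
theorem wp_costMatrix {n : ℕ} {e₀ e f : IExp} {E F : ℕ → ℕ → ℕ → ℕ} {s : Mem R}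
    (hN : s.ireg 2 = N) (hL : N ≤ L) (hn : n ≤ L) (hb : ∀ i ≤ N, s.iarr 1 i = i * N)
    (he₀ : ∀ s', Frame (costMatrix e₀ e f) s s' → e₀.eval s' = n)
    (he : ∀ s', Frame (costMatrix e₀ e f) s s' → s'.ireg 4 < N → s'.ireg 5 < N →
      s'.ireg 11 < n → e.eval s' = E (s'.ireg 4) (s'.ireg 5) (s'.ireg 11))
    (hf : ∀ s', Frame (costMatrix e₀ e f) s s' → s'.ireg 4 < N → s'.ireg 5 < N →
      s'.ireg 11 < n → f.eval s' = F (s'.ireg 4) (s'.ireg 5) (s'.ireg 11)) :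
    wp L (costMatrix e₀ e f) (fun s' => ∀ i < N, ∀ j < N, s'.varr 2 (i * N + j) =
      ∑ l ∈ Finset.range n, |s.varr 0 (E i j l) - s.varr 1 (F i j l)|) s := by
  have hv : ∀ s', Frame (costMatrix e₀ e f) s s' → s'.varr 0 = s.varr 0 ∧ s'.varr 1 = s.varr 1 :=
    fun s' hF => ⟨hF.varr 0 (by simp [costMatrix]), hF.varr 1 (by simp [costMatrix])⟩
  refine wp_forLoop_frame (fun i s' => ∀ x < i, ∀ j < N, s'.varr 2 (x * N + j) =
      ∑ l ∈ Finset.range n, |s.varr 0 (E x j l) - s.varr 1 (F x j l)|) hL (by simp)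
      (fun s' hF => ?_) (by simp) ?_ (fun _ _ h => h)
  · simpa [hN] using hF.ireg 2 (by simp)
  intro i s₁ hi hF₁ h4 hI₁
  have a2 : s₁.ireg 2 = N := by simpa [hN] using hF₁.ireg 2 (by simp)
  refine wp_forLoop_frame (fun t s' => ∀ x j, j < N → x < i ∨ (x = i ∧ j < t) →
      s'.varr 2 (x * N + j) =
        ∑ l ∈ Finset.range n, |s.varr 0 (E x j l) - s.varr 1 (F x j l)|) hL (by simp)
      (fun s' hF => ?_) ?_ ?_ ?_
  · simpa [a2] using hF.ireg 2 (by simp)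
  · exact fun x j hj h => hI₁ x (by omega) j hj
  · intro j s₂ hj hF₂ h5 hI₂
    have h4₂ : s₂.ireg 4 = i := by simpa [h4] using hF₂.ireg 4 (by simp)
    have hF₂' : Frame (costMatrix e₀ e f) s s₂ :=
      hF₁.trans (hF₂.mono fun l hl => writes_forLoop.2 (.inr hl))
    have hF₂'' : Frame (costMatrix e₀ e f) s (s₂.setVreg 2 0) := by
      refine hF₂'.trans ⟨fun _ _ => rfl, fun _ _ => rfl, fun y hy => ?_, fun _ _ => rfl⟩
      rw [vreg_setVreg, if_neg]
      rintro rfl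
      exact hy (by simp [costMatrix])
    simp only [wp, VExp.eval]
    refine wp_forLoop_frame (fun t s' => s'.vreg 2 =
        ∑ l ∈ Finset.range t, |s.varr 0 (E i j l) - s.varr 1 (F i j l)|) hn (by simp)
        (fun s' hF => he₀ s' (hF₂''.trans (hF.mono ?_))) (by simp) ?_ ?_
    · exact fun l hl => by
        simp only [costMatrix, writes_forLoop, Prog.Writes] at hl ⊢
        tauto
    · intro l s₃ hl hF₃ h11 hI₃
      have hF₃' : Frame (costMatrix e₀ e f) s s₃ := hF₂''.trans (hF₃.mono fun l hl => by
        simp only [costMatrix, writes_forLoop, Prog.Writes] at hl ⊢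
        tauto)
      have b4 : s₃.ireg 4 = i := by simpa [h4₂] using hF₃.ireg 4 (by simp)
      have b5 : s₃.ireg 5 = j := by simpa [h5] using hF₃.ireg 5 (by simp)
      have eE := he s₃ hF₃' (by rwa [b4]) (by rwa [b5]) (by rwa [h11])
      have eF := hf s₃ hF₃' (by rwa [b4]) (by rwa [b5]) (by rwa [h11])
      rw [b4, b5, h11] at eE eF
      have ev := hv s₃ hF₃'
      simp only [wp, Test.Holds, VExp.eval, eE, eF, ev, vreg_setVreg, vreg_setIreg, reduceIte,
        Nat.reduceEqDiff, hI₃, Finset.sum_range_succ]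
      -- The absolute value is obtained by branching on the sign of the difference.
      refine ⟨fun h => ?_, fun h => ?_⟩
      · rw [abs_of_neg h, sub_eq_add_neg]
      · rw [abs_of_nonneg (not_lt.1 h)]
    · intro s₃ hF₃ hI₃ x y hy h
      have c1 : s₃.iarr 1 = s.iarr 1 := by
        have := hF₃.iarr 1 (by simp)
        rw [this]
        exact hF₂''.iarr 1 (by simp [costMatrix])
      have c4 : s₃.ireg 4 = i := by simpa [h4₂] using hF₃.ireg 4 (by simp)
      have c5 : s₃.ireg 5 = j := by simpa [h5] using hF₃.ireg 5 (by simp)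
      have c2 : s₃.varr 2 = s₂.varr 2 := by simpa using hF₃.varr 2 (by simp)
      simp only [IExp.eval, varr_setIreg, varr_setVarr, c1, c4, c5, hb i hi.le,
        mul_add_inj hy hj, true_and, hI₃, c2]
      split_ifs with hxy
      · rw [hxy.1, hxy.2]
      · exact hI₂ x y hy (by omega)
  · exact fun s' _ h x hx j hj => by simpa using h x j hj (by omega)

end Specs

end RAM

namespace RAM

/-! ### Reduction of the two problems to the assignment problem. -/

/-- Compute a cost matrix whose order is in the register `q`, and compare the least cost of a
permutation to the threshold. -/
def assignment (q : ℕ) (e₀ e f : IExp) : Prog :=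
  .seq (.iset 2 (.reg q)) <| .seq (multiples 1 (.reg 2) (.reg 2)) <|
  .seq (multiples 5 (.reg 0) (.reg 1)) <| .seq (costMatrix e₀ e f) <| .seq hungarian compareSum

/-- The program for a fixed agent matching. -/
def fixedAgent : Prog :=
  assignment 1 (.reg 0) (.add (.arr 5 (.reg 11)) (.reg 4))
    (.add (.arr 5 (.arr 0 (.reg 11))) (.reg 5))

/-- The program for a fixed good matching. -/
def fixedGood : Prog :=
  assignment 0 (.reg 1) (.add (.arr 5 (.reg 4)) (.reg 11))
    (.add (.arr 5 (.reg 5)) (.arr 0 (.reg 11)))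

section Specs

variable {R : Type} [AddCommGroup R] [LinearOrder R] [IsOrderedAddMonoid R] {L N n m k : ℕ}

theorem wp_assignment {q ℓ : ℕ} {e₀ e f : IExp} {E F : ℕ → ℕ → ℕ → ℕ}
    {U U' : Matrix (Fin n) (Fin m) R} {π : Equiv.Perm (Fin k)} {d : R}
    (hq : (inputMem U U' π d).ireg q = N) (hN : 0 < N) (hL : (N + 1) * (N + 1) ≤ L) (hn : n ≤ L)
    (hℓ : ℓ ≤ L)
    (he₀ : ∀ s : Mem R, s.ireg 0 = n → s.ireg 1 = m → e₀.eval s = ℓ)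
    (he : ∀ s : Mem R, (∀ i ≤ n, s.iarr 5 i = i * m) → s.iarr 0 = permTable π → s.ireg 4 < N →
      s.ireg 5 < N → s.ireg 11 < ℓ → e.eval s = E (s.ireg 4) (s.ireg 5) (s.ireg 11))
    (hf : ∀ s : Mem R, (∀ i ≤ n, s.iarr 5 i = i * m) → s.iarr 0 = permTable π → s.ireg 4 < N →
      s.ireg 5 < N → s.ireg 11 < ℓ → f.eval s = F (s.ireg 4) (s.ireg 5) (s.ireg 11))
    {D : R} (hD : D = Finset.univ.inf' Finset.univ_nonempty fun σ : Equiv.Perm (Fin N) =>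
      ∑ i : Fin N, ∑ l ∈ Finset.range ℓ, |rowMajor U (E i (σ i) l) - rowMajor U' (F i (σ i) l)|) :
    wp L (assignment q e₀ e f) (fun s' => (D ≤ d → s'.ireg 0 = 1) ∧ (¬ D ≤ d → s'.ireg 0 = 0))
      (inputMem U U' π d) := by
  have hLN : N ≤ L := by nlinarith
  simp only [assignment]
  rw [wp, wp]
  set s₀ := (inputMem U U' π d).setIreg 2 ((IExp.reg q).eval (inputMem U U' π d)) with hs₀
  have a2 : s₀.ireg 2 = N := by simpa [hs₀] using hq
  rw [wp]
  refine (wp_multiples (e := .reg 2) (f := .reg 2) (n := N) (k := N) hLN (by simp [hs₀, inputMem])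
    (fun s' hF => (hF.ireg 2 (by simp [multiples])).trans a2)
    (fun s' hF => (hF.ireg 2 (by simp [multiples])).trans a2)).frame.imp fun s₁ ⟨hb₁, F₁⟩ => ?_
  have b0 : s₁.ireg 0 = n := (F₁.ireg 0 (by simp [multiples])).trans (by simp [hs₀, inputMem])
  have b1 : s₁.ireg 1 = m := (F₁.ireg 1 (by simp [multiples])).trans (by simp [hs₀, inputMem])
  rw [wp]
  refine (wp_multiples (e := .reg 0) (f := .reg 1) (n := n) (k := m) hn
    (by rw [F₁.iarr 5 (by simp [multiples])]; simp [hs₀, inputMem])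
    (fun s' hF => (hF.ireg 0 (by simp [multiples])).trans b0)
    (fun s' hF => (hF.ireg 1 (by simp [multiples])).trans b1)).frame.imp fun s₂ ⟨hb₂, F₂⟩ => ?_
  have c2 : s₂.ireg 2 = N :=
    ((F₂.ireg 2 (by simp [multiples])).trans (F₁.ireg 2 (by simp [multiples]))).trans a2
  have c0 : s₂.ireg 0 = n := (F₂.ireg 0 (by simp [multiples])).trans b0
  have c1 : s₂.ireg 1 = m := (F₂.ireg 1 (by simp [multiples])).trans b1
  have ca : s₂.iarr 0 = permTable π :=
    ((F₂.iarr 0 (by simp [multiples])).trans (F₁.iarr 0 (by simp [multiples]))).trans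
      (by funext; simp [hs₀, inputMem])
  have ca2 : ∀ x, s₂.iarr 2 x = 0 := by
    intro x
    rw [F₂.iarr 2 (by simp [multiples]), F₁.iarr 2 (by simp [multiples])]
    simp [hs₀, inputMem]
  have ca3 : ∀ x, s₂.iarr 3 x = 0 := by
    intro x
    rw [F₂.iarr 3 (by simp [multiples]), F₁.iarr 3 (by simp [multiples])]
    simp [hs₀, inputMem]
  have cv : s₂.varr = (inputMem U U' π d).varr := by
    funext a
    rw [F₂.varr a (by simp [multiples]), F₁.varr a (by simp [multiples])]
    rfl
  have cd : s₂.vreg 0 = d := by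
    rw [F₂.vreg 0 (by simp [multiples]), F₁.vreg 0 (by simp [multiples])]
    rfl
  have hb₁' : ∀ i ≤ N, s₂.iarr 1 i = i * N := by
    rw [F₂.iarr 1 (by simp [multiples])]
    exact hb₁
  rw [wp]
  refine (wp_costMatrix (E := E) (F := F) c2 hLN hℓ hb₁'
    (fun s' hF => he₀ s' ((hF.ireg 0 (by simp [costMatrix])).trans c0)
      ((hF.ireg 1 (by simp [costMatrix])).trans c1))
    (fun s' hF => he s' (by rw [hF.iarr 5 (by simp [costMatrix])]; exact hb₂)
      ((hF.iarr 0 (by simp [costMatrix])).trans ca))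
    (fun s' hF => hf s' (by rw [hF.iarr 5 (by simp [costMatrix])]; exact hb₂)
      ((hF.iarr 0 (by simp [costMatrix])).trans ca))).frame.imp fun s₃ ⟨hc, F₃⟩ => ?_
  have e2 : s₃.ireg 2 = N := (F₃.ireg 2 (by simp [costMatrix])).trans c2
  rw [wp]
  refine (wp_hungarian e2 hN hL (by rw [F₃.iarr 1 (by simp [costMatrix])]; exact hb₁') hc
    (fun i _ j _ => Finset.sum_nonneg fun l _ => abs_nonneg _)
    (by rw [F₃.iarr 2 (by simp [costMatrix])]; exact ca2)
    (by rw [F₃.iarr 3 (by simp [costMatrix])]; exact ca3)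
    (by rw [F₃.varr 3 (by simp [costMatrix]), cv]; simp [inputMem])
    (by rw [F₃.varr 4 (by simp [costMatrix]), cv]; simp [inputMem])).frame.imp
    fun s₄ ⟨hsum, F₄⟩ => ?_
  have g2 : s₄.ireg 2 = N := (F₄.ireg 2 (by
    simp [hungarian, round, search, shift, findRow, advance, nextRow, growTree, copyTable])).trans e2
  have g0 : s₄.vreg 0 = d := by
    rw [F₄.vreg 0 (by
      simp [hungarian, round, search, shift, findRow, advance, nextRow, growTree, copyTable]),
      F₃.vreg 0 (by simp [costMatrix]), cd]
  have hD' : D = ∑ x ∈ Finset.range N, (s₄.varr 3 x + s₄.varr 4 x) := by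
    rw [hsum, hD, cv]
    rfl
  refine (wp_compareSum g2 hLN).imp fun s₅ h => ?_
  rwa [g0, ← hD'] at h

theorem rowMajor_mul_add (U : Matrix (Fin n) (Fin m) R) (i : Fin n) (j : Fin m) :
    rowMajor U (i * m + j) = U i j := by
  have hlt : (i : ℕ) * m + j < n * m := by
    have := Nat.mul_le_mul_right m i.2
    have := j.2
    rw [Nat.succ_mul] at *
    omega
  rw [rowMajor, dif_pos hlt]
  congr 1
  · ext
    simp only [Fin.divNat]
    rw [Nat.mul_comm, Nat.mul_add_div (j.pos), Nat.div_eq_of_lt j.2, add_zero]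
  · ext
    simp only [Fin.modNat]
    rw [Nat.mul_comm, Nat.mul_add_mod, Nat.mod_eq_of_lt j.2]

theorem permTable_apply (π : Equiv.Perm (Fin k)) (i : Fin k) : permTable π i = π i := by
  simp [permTable]

theorem wp_fixedAgent (hn : 0 < n) (hm : 0 < m) (hL : (n * m + 1) * (n * m + 1) ≤ L)
    (U U' : Matrix (Fin n) (Fin m) R) (π : Equiv.Perm (Fin n)) (d : R) :
    wp L fixedAgent (fun s' => (agentDist U U' π ≤ d → s'.ireg 0 = 1) ∧
      (¬ agentDist U U' π ≤ d → s'.ireg 0 = 0)) (inputMem U U' π d) := by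
  have hnm : n ≤ n * m := Nat.le_mul_of_pos_right n hm
  have hmn : m ≤ n * m := Nat.le_mul_of_pos_left m hn
  refine wp_assignment (N := m) (ℓ := n) (e₀ := .reg 0) (E := fun g _ l => l * m + g)
    (F := fun _ h l => permTable π l * m + h) rfl hm ((Nat.mul_le_mul (by omega) (by omega)).trans hL)
    (by nlinarith) (by nlinarith) (fun s h _ => h) ?_ ?_ ?_
  · intro s hb _ _ _ hl
    simp [hb _ hl.le]
  · intro s hb hp _ _ hl
    have : permTable π (s.ireg 11) ≤ n := by
      rw [← Fin.val_mk hl, permTable_apply]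
      exact (π _).2.le
    simp [hp, hb _ this]
  · unfold agentDist matchingDist
    congr 1
    funext σ
    -- The good matching is the unknown, so the sum over goods has to be the outer one.
    rw [Finset.sum_comm]
    refine Finset.sum_congr rfl fun j _ => ?_
    rw [Finset.sum_range]
    refine Finset.sum_congr rfl fun i _ => ?_
    rw [rowMajor_mul_add, permTable_apply, rowMajor_mul_add]

theorem wp_fixedGood (hn : 0 < n) (hm : 0 < m) (hL : (n * m + 1) * (n * m + 1) ≤ L)
    (U U' : Matrix (Fin n) (Fin m) R) (π : Equiv.Perm (Fin m)) (d : R) :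
    wp L fixedGood (fun s' => (goodDist U U' π ≤ d → s'.ireg 0 = 1) ∧
      (¬ goodDist U U' π ≤ d → s'.ireg 0 = 0)) (inputMem U U' π d) := by
  have hnm : n ≤ n * m := Nat.le_mul_of_pos_right n hm
  have hmn : m ≤ n * m := Nat.le_mul_of_pos_left m hn
  refine wp_assignment (N := n) (ℓ := m) (e₀ := .reg 1) (E := fun i _ l => i * m + l)
    (F := fun _ i l => i * m + permTable π l) rfl hn ((Nat.mul_le_mul (by omega) (by omega)).trans hL)
    (by nlinarith) (by nlinarith) (fun s _ h => h) ?_ ?_ ?_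
  · intro s hb _ hi _ _
    simp [hb _ hi.le]
  · intro s hb hp _ hi _
    simp [hp, hb _ hi.le]
  · unfold goodDist matchingDist
    congr 1
    funext σ
    refine Finset.sum_congr rfl fun i _ => ?_
    rw [Finset.sum_range]
    refine Finset.sum_congr rfl fun j _ => ?_
    rw [rowMajor_mul_add, permTable_apply, rowMajor_mul_add]

end Specs

/-! ## Polynomial bounds -/

section Bounds

variable {R : Type} [AddCommGroup R] [LinearOrder R] {n m k : ℕ}

/-- The size function `sz` is tame if the numbers of every input have levels for a filtration with
bounds that are linear in the length of the input. -/
def Tame (sz : R → ℕ) : Prop :=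
  ∀ {n m k : ℕ} (U U' : Matrix (Fin n) (Fin m) R) (π : Equiv.Perm (Fin k)) (d : R),
    n * m ≤ inputSize sz U U' π d ∧
    ∃ (K : ℕ) (V : ℕ → R → Prop), Filtration sz K V ∧ K ≤ inputSize sz U U' π d + 2 ∧
      (inputMem U U' π d).Level V (2 * inputSize sz U U' π d)

/-- The polynomial is chosen before the group of values and its size function, which lets it serve
`ℚ` and `ℝ` at once. -/
theorem exists_polynomial_decides (P : Prog) :
    ∃ p : Polynomial ℕ, ∀ {R : Type} [AddCommGroup R] [LinearOrder R] {sz : R → ℕ} {K : ℕ}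
      {V : ℕ → R → Prop}, Filtration sz K V → ∀ {ℓ : ℕ}, K ≤ ℓ + 2 → ∀ {s : Mem R},
      s.Level V (2 * ℓ) → ∀ {A : Prop},
      wp ((ℓ + 1) * (ℓ + 1)) P (fun s' => (A → s'.ireg 0 = 1) ∧ (¬ A → s'.ireg 0 = 0)) s →
      Decides sz P s (p.eval ℓ) A := by
  obtain ⟨q, hq⟩ := P.exists_polynomial_ops
  let t : Polynomial ℕ := q.comp ((Polynomial.X + 1) * (Polynomial.X + 1))
  -- At most `t` operations, each charged `K + L + 2`, with `K ≤ ℓ + 2` and final level `L = 2 * ℓ +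
  -- t`.
  refine ⟨t * (Polynomial.X + 2 + (2 * Polynomial.X + t) + 2), ?_⟩
  intro R _ _ sz K V hV ℓ hK s hs A h
  have ht : t.eval ℓ = P.ops ((ℓ + 1) * (ℓ + 1)) := by simp [t, hq]
  obtain ⟨c, s', he, hA, -, hc⟩ := h.exec hV hs le_rfl
  refine ⟨c, s', he, hc.trans ?_, hA.1, hA.2⟩
  simp only [Polynomial.eval_mul, Polynomial.eval_add, Polynomial.eval_X, Polynomial.eval_ofNat, ht]
  exact Nat.mul_le_mul_left _ (by omega)

theorem mul_le_inputSize {sz : R → ℕ} (h : ∀ v, 1 ≤ sz v) (U U' : Matrix (Fin n) (Fin m) R)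
    (π : Equiv.Perm (Fin k)) (d : R) : n * m ≤ inputSize sz U U' π d := by
  have : ∑ _i : Fin n, ∑ _j : Fin m, 1 ≤ ∑ i, ∑ j, sz (U i j) :=
    Finset.sum_le_sum fun i _ => Finset.sum_le_sum fun j _ => h _
  simp only [Finset.sum_const, Finset.card_univ, Fintype.card_fin, smul_eq_mul, mul_one] at this
  unfold inputSize
  omega

theorem le_two_pow_of_size_le {a ℓ : ℕ} (h : Nat.size a ≤ ℓ) : a ≤ 2 ^ (2 * ℓ) :=
  (Nat.lt_size_self a).le.trans (Nat.pow_le_pow_right two_pos (by omega))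

theorem level_inputMem {sz : R → ℕ} {K : ℕ} {V : ℕ → R → Prop} (hV : Filtration sz K V)
    (U U' : Matrix (Fin n) (Fin m) R) (π : Equiv.Perm (Fin k)) (d : R)
    (hU : ∀ i j, V (2 * inputSize sz U U' π d) (U i j))
    (hU' : ∀ i j, V (2 * inputSize sz U U' π d) (U' i j))
    (hd : V (2 * inputSize sz U U' π d) d) :
    (inputMem U U' π d).Level V (2 * inputSize sz U U' π d) where
  ireg x := by
    simp only [inputMem]
    split_ifs
    · exact le_two_pow_of_size_le (by unfold inputSize; omega)
    · exact le_two_pow_of_size_le (by unfold inputSize; omega)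
    · exact Nat.zero_le _
  iarr a t := by
    simp only [inputMem, permTable]
    split_ifs with _ ht
    · refine le_two_pow_of_size_le ?_
      have := Finset.single_le_sum (f := fun i => 1 + Nat.size (π i : ℕ)) (fun _ _ => Nat.zero_le _)
        (Finset.mem_univ ⟨t, ht⟩)
      unfold inputSize
      omega
    · exact Nat.zero_le _
    · exact Nat.zero_le _
  vreg x := by
    simp only [inputMem]
    split_ifs
    · exact hd
    · exact hV.zero _
  varr a t := by
    simp only [inputMem, rowMajor]
    split_ifs
    · exact hU _ _
    · exact hV.zero _
    · exact hU' _ _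
    · exact hV.zero _
    · exact hV.zero _

/-! ### Tameness of the unit size and of the binary size. -/

theorem tame_realSize : Tame realSize := fun U U' π d => by
  have hV : Filtration realSize 1 fun _ _ => True :=
    ⟨fun _ _ => trivial, fun _ => trivial, fun _ _ => trivial, fun _ _ => trivial,
      fun _ => by unfold realSize; omega⟩
  exact ⟨mul_le_inputSize (fun _ => le_rfl) U U' π d, 1, _, hV, by omega,
    level_inputMem hV U U' π d (fun _ _ => trivial) (fun _ _ => trivial) trivial⟩

/-- The fractions with denominator `D` and numerator at most `2 ^ k`. -/
def FractionLevel (D k : ℕ) (v : ℚ) : Prop :=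
  ∃ z : ℤ, v * D = z ∧ |z| ≤ 2 ^ k

/-- Reduced denominators divide `D`, so their length never exceeds that of `D`; a numerator at level
`k` has length at most `k + 1`. -/
theorem filtration_fractionLevel {D : ℕ} (hD : 0 < D) :
    Filtration ratSize (Nat.size D + 1) (FractionLevel D) where
  mono := fun h ⟨z, hz, hle⟩ => ⟨z, hz, hle.trans (pow_le_pow_right₀ one_le_two h)⟩
  zero k := ⟨0, by simp, by simp⟩
  add := by
    rintro k v w ⟨z, hz, hle⟩ ⟨z', hz', hle'⟩
    refine ⟨z + z', by rw [add_mul, hz, hz']; push_cast; rfl, (abs_add_le _ _).trans ?_⟩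
    rw [pow_succ]
    omega
  sub := by
    rintro k v w ⟨z, hz, hle⟩ ⟨z', hz', hle'⟩
    refine ⟨z - z', by rw [sub_mul, hz, hz']; push_cast; rfl, (abs_sub _ _).trans ?_⟩
    rw [pow_succ]
    omega
  size := by
    rintro k v ⟨z, hz, hle⟩
    have hv : v = z / (D : ℤ) := by
      rw [eq_div_iff (by exact_mod_cast hD.ne'), ← hz]
      simp
    have hden : v.den ≤ D := by
      refine Nat.le_of_dvd hD ?_
      have := Rat.den_dvd z D
      rw [hv]
      exact_mod_cast this
    have hnum : v.num.natAbs ≤ 2 ^ k := by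
      have h₁ : v.num ∣ z := by
        have := Rat.num_dvd z (b := D) (by exact_mod_cast hD.ne')
        rw [hv]
        exact_mod_cast this
      have h₂ : z.natAbs ≤ 2 ^ k := by
        zify
        exact hle
      rcases eq_or_ne z 0 with rfl | hz0
      · have : v = 0 := by simpa using hv
        simp [this]
      · exact (Int.natAbs_le_of_dvd_ne_zero h₁ hz0).trans h₂
    have := natSize_le_of_le_two_pow hnum
    have := Nat.size_le_size hden
    unfold ratSize
    omega

/-- Passing to the denominator `D` multiplies the numerator by a cofactor; both are at most `2 ^ ℓ`,
whence the level `2 * ℓ`. -/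
theorem fractionLevel_of_den_dvd {D ℓ : ℕ} {v : ℚ} (hD : D ≤ 2 ^ ℓ) (hdvd : v.den ∣ D)
    (hv : ratSize v ≤ ℓ) : FractionLevel D (2 * ℓ) v := by
  obtain ⟨t, rfl⟩ := hdvd
  refine ⟨v.num * t, ?_, ?_⟩
  · push_cast
    rw [← mul_assoc, Rat.mul_den_eq_num]
  · have h₁ : v.num.natAbs ≤ 2 ^ ℓ :=
      (Nat.lt_size_self _).le.trans
        (Nat.pow_le_pow_right two_pos (by unfold ratSize at hv; omega))
    have h₂ : t ≤ 2 ^ ℓ := (Nat.le_mul_of_pos_left t v.den_pos).trans hD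
    have h₃ := Nat.mul_le_mul h₁ h₂
    rw [← pow_add, ← two_mul] at h₃
    rw [abs_mul, Int.abs_eq_natAbs, Nat.abs_cast]
    exact_mod_cast h₃

theorem prod_den_le (U : Matrix (Fin n) (Fin m) ℚ) :
    ∏ i, ∏ j, (U i j).den ≤ 2 ^ ∑ i, ∑ j, ratSize (U i j) := by
  simp only [← Finset.prod_pow_eq_pow_sum]
  refine Finset.prod_le_prod' fun i _ => Finset.prod_le_prod' fun j _ => ?_
  exact (Nat.lt_size_self _).le.trans (Nat.pow_le_pow_right two_pos (by unfold ratSize; omega))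

theorem den_dvd_prod (U : Matrix (Fin n) (Fin m) ℚ) (i : Fin n) (j : Fin m) :
    (U i j).den ∣ ∏ i, ∏ j, (U i j).den :=
  (Finset.dvd_prod_of_mem (fun j => (U i j).den) (Finset.mem_univ j)).trans
    (Finset.dvd_prod_of_mem (fun i => ∏ j, (U i j).den) (Finset.mem_univ i))

theorem le_sum_entries (f : Fin n → Fin m → ℕ) (i : Fin n) (j : Fin m) :
    f i j ≤ ∑ i, ∑ j, f i j :=
  (Finset.single_le_sum (f := fun j => f i j) (fun _ _ => Nat.zero_le _) (Finset.mem_univ j)).trans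
    (Finset.single_le_sum (f := fun i => ∑ j, f i j) (fun _ _ => Nat.zero_le _)
      (Finset.mem_univ i))

theorem tame_ratSize : Tame ratSize := fun {n m k} U U' π d => by
  have hpos : ∀ v : ℚ, 1 ≤ ratSize v := fun v => by
    have := Nat.size_pos.2 v.den_pos
    unfold ratSize
    omega
  -- The plain product is a good enough common denominator: its logarithm is at most the sum of the
  -- sizes of the inputs.
  set D := (∏ i, ∏ j, (U i j).den) * (∏ i, ∏ j, (U' i j).den) * d.den with hD
  have hD0 : 0 < D := Nat.mul_pos (Nat.mul_pos
    (Finset.prod_pos fun i _ => Finset.prod_pos fun j _ => (U i j).den_pos)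
    (Finset.prod_pos fun i _ => Finset.prod_pos fun j _ => (U' i j).den_pos)) d.den_pos
  have hDle : D ≤ 2 ^ inputSize ratSize U U' π d := by
    have hd : d.den ≤ 2 ^ ratSize d :=
      (Nat.lt_size_self _).le.trans (Nat.pow_le_pow_right two_pos (by unfold ratSize; omega))
    refine (Nat.mul_le_mul (Nat.mul_le_mul (prod_den_le U) (prod_den_le U')) hd).trans ?_
    rw [← pow_add, ← pow_add]
    exact Nat.pow_le_pow_right two_pos (by unfold inputSize; omega)
  have hV := filtration_fractionLevel hD0
  refine ⟨mul_le_inputSize hpos U U' π d, _, _, hV, ?_, level_inputMem hV U U' π d ?_ ?_ ?_⟩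
  · have := natSize_le_of_le_two_pow hDle
    omega
  · intro i j
    refine fractionLevel_of_den_dvd hDle (((den_dvd_prod U i j).mul_right _).mul_right _) ?_
    have := le_sum_entries (fun i j => ratSize (U i j)) i j
    unfold inputSize
    omega
  · intro i j
    refine fractionLevel_of_den_dvd hDle (((den_dvd_prod U' i j).mul_left _).mul_right _) ?_
    have := le_sum_entries (fun i j => ratSize (U' i j)) i j
    unfold inputSize
    omega
  · refine fractionLevel_of_den_dvd hDle (Dvd.intro_left _ rfl) ?_
    unfold inputSize
    omega

theorem exists_polynomial_solvesFixedAgent :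
    ∃ p : Polynomial ℕ, ∀ {R : Type} [AddCommGroup R] [LinearOrder R] [IsOrderedAddMonoid R]
      {sz : R → ℕ}, Tame sz → SolvesFixedAgent sz fixedAgent p := by
  obtain ⟨p, hp⟩ := exists_polynomial_decides fixedAgent
  refine ⟨p, fun {R} _ _ _ sz hsz n m hn hm U U' _ _ π d => ?_⟩
  obtain ⟨hle, K, V, hV, hK, hs⟩ := hsz U U' π d
  exact hp hV hK hs (wp_fixedAgent hn hm (Nat.mul_le_mul (by omega) (by omega)) U U' π d)

theorem exists_polynomial_solvesFixedGood :
    ∃ p : Polynomial ℕ, ∀ {R : Type} [AddCommGroup R] [LinearOrder R] [IsOrderedAddMonoid R]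
      {sz : R → ℕ}, Tame sz → SolvesFixedGood sz fixedGood p := by
  obtain ⟨p, hp⟩ := exists_polynomial_decides fixedGood
  refine ⟨p, fun {R} _ _ _ sz hsz n m hn hm U U' _ _ π d => ?_⟩
  obtain ⟨hle, K, V, hV, hK, hs⟩ := hsz U U' π d
  exact hp hV hK hs (wp_fixedGood hn hm (Nat.mul_le_mul (by omega) (by omega)) U U' π d)

end Bounds

end RAM

theorem mainTheorem8 :
    (∃ (P : RAM.Prog) (p : Polynomial ℕ),
      RAM.SolvesFixedAgent RAM.ratSize P p ∧ RAM.SolvesFixedAgent RAM.realSize P p) ∧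
    (∃ (P : RAM.Prog) (p : Polynomial ℕ),
      RAM.SolvesFixedGood RAM.ratSize P p ∧ RAM.SolvesFixedGood RAM.realSize P p) := by
  obtain ⟨p, hp⟩ := RAM.exists_polynomial_solvesFixedAgent
  obtain ⟨q, hq⟩ := RAM.exists_polynomial_solvesFixedGood
  exact ⟨⟨RAM.fixedAgent, p, hp RAM.tame_ratSize, hp RAM.tame_realSize⟩,
    ⟨RAM.fixedGood, q, hq RAM.tame_ratSize, hq RAM.tame_realSize⟩⟩
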